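/- **Conventions.** A Cantor set $K\subset\mathbb C$ is a nonempty compact, perfect, totally disconnected set. A simple path $\gamma$ from $z_0$ to $z_1$ is a continuous injective map $\gamma:[0,1]\to\mathbb C$ with $\gamma(0)=z_0$, $\gamma(1)=z_1$. For $\varepsilon>0$, a simple path $\eta$ from $z_0$ to $z_1$ is *$\varepsilon$-Jordan homotopic* to $\gamma$ if the Hausdorff distance of $\eta([0,1])$ and $\gamma([0,1])$ is less than $\varepsilon$ and $\eta([0,1])\cup\gamma([0,1])$ is a Jordan curve (the boundary of a Jordan domain). For a finite complex Borel measure $\nu$ on $\mathbb C$ let $f_\nu(z)=\frac1{2\pi i}\int_{\mathbb C}\frac{d\nu(t)}{z-t}$ be its Cauchy transform and $\operatorname{supp}\nu$ its closed support. Integrals $\int_\gamma f(t)\,dt$ are Riemann–Stieltjes integrals along $\gamma$. The *polar measure* of a rational function $R$ is $\mu_R=\sum_\rho(\operatorname{Res}_\rho R)\,\delta_\rho$, the sum over the poles in $\mathbb C$. A sequence $(f_n)$ of rational functions is *asymptotically holomorphic* on $\gamma$ if $|\mu_{f_n}|(\mathbb C)\le M$ for some $M$ and all $n$, all poles in $\mathbb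 C$ are simple and lie outside $\gamma([0,1])$, and $\lim_{\varepsilon\to0}\limsup_{n}|\mu_{f_n}(V_\varepsilon)|=0$, where $V_\varepsilon$ is the $\varepsilon$-neighbourhood of $\gamma([0,1])$. Let $F:U\to\mathbb C$ be holomorphic on an open neighbourhood $U$ of $z_0$. If functions $f_n$ converge uniformly on $\gamma([0,1])$ to a continuous function $f$ with $f=F'$ on $U\cap\gamma([0,1])$, then $w\in\mathbb C$ is the (finite) *Borel extension* of $F$ at $z_1$ along $\gamma$ for the sequence $(f_n)$ if $$w-F(z_0)=\int_\gamma f(t)\,dt=\lim_{n\to\infty}\int_\gamma f_n(t)\,dt ,$$ where the integrals of $f$ and of $f_n$ for large $n$ are required to exist. **Statement.** Let $K\subset\mathbb C$ be a Cantor set and $\gamma$ a simple path from $z_0$ to $z_1$. (1) (Lemma) For every $\varepsilon>0$ there is a simple path $\eta$ that is $\varepsilon$-Jordan homotopic to $\gamma$ and satisfies $\eta(t)\notin K$ for $0<t<1$. (2) (Proposition) Let $\mu$ be a finite complex Borel measure with $\operatorname{supp}\mu=K$ and $\mu(\gamma([0,1]))=0$, and let $F:U\to\mathbb C$ be holomorphic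 on an open neighbourhood $U$ of $z_0$ with $F'=f_\mu$ on $U$. Consider the sequences $(f_n)$ of either of the following kinds: (a) $(f_n)$ is an asymptotically holomorphic sequence on $\gamma$ of rational functions vanishing at infinity (so that $f_n=f_{\nu_n}$ with $\nu_n=2\pi i\,\mu_{f_n}$), with $\nu_n\to\mu$ weakly and $\operatorname{supp}\nu_n\to\operatorname{supp}\mu$ in the Hausdorff distance; (b) more generally, $f_n=f_{\nu_n}$ for finite complex Borel measures $\nu_n$ with $|\nu_n|(\mathbb C)\le M$ for some $M$ and all $n$, with $\int |z-t|^{-1}\,d|\nu_n|(t)<\infty$ for every $z\in\gamma([0,1])$, and with $\nu_n\to\mu$ weakly and $\operatorname{supp}\nu_n\to\operatorname{supp}\mu$ in the Hausdorff distance. Then the Borel extension of $F$ at $z_1$ along $\gamma$ does not depend on the sequence: if $(f_n)$ and $(g_n)$ are two such sequences, each of kind (a) or (b), and $w,w'\in\mathbb C$ are (finite) Borel extensions of $F$ at $z_1$ along $\gamma$ for $(f_n)$ and $(g_n)$ respectively, then $w=w'$. -/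

import Mathlib

open MeasureTheory Filter Topology Set

noncomputable section

/-- A Cantor set in the plane: nonempty, compact, without isolated points, totally disconnected. -/
structure IsPlaneCantorSet (K : Set ℂ) : Prop where
  nonempty : K.Nonempty
  isCompact : IsCompact K
  preperfect : Preperfect K
  totallyDisconnected : IsTotallyDisconnected K

/-- A Jordan curve: a homeomorphic image of the circle in the plane. -/
def IsJordanCurve (S : Set ℂ) : Prop :=
  ∃ φ : Circle → ℂ, Continuous φ ∧ Function.Injective φ ∧ range φ = S

/-- `η` is `ε`-Jordan homotopic to the simple path `γ`: it is a simple path with the same endpoints,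
the two supports are `ε`-close in the Hausdorff distance, and together they form a Jordan curve,
i.e. they bound a Jordan domain. -/
structure IsJordanHomotopic {z₀ z₁ : ℂ} (ε : ℝ) (γ η : Path z₀ z₁) : Prop where
  injective : Function.Injective η
  close : Metric.hausdorffDist (range η) (range γ) < ε
  jordan : IsJordanCurve (range η ∪ range γ)

/-- `∫_γ f(t) dt = I` as a Riemann-Stieltjes integral: the sums
`∑ f(γ(s_k)) (γ(t_{k+1}) - γ(t_k))` over tagged subdivisions `0 = t_0 ≤ ⋯ ≤ t_N = 1` with
`s_k ∈ [t_k, t_{k+1}]` tend to `I` as the mesh tends to `0`. -/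
def HasPathIntegral {z₀ z₁ : ℂ} (γ : Path z₀ z₁) (f : ℂ → ℂ) (I : ℂ) : Prop :=
  ∀ ε > (0 : ℝ), ∃ δ > (0 : ℝ), ∀ (N : ℕ) (t s : ℕ → unitInterval),
    Monotone t → t 0 = 0 → t N = 1 →
    (∀ k < N, t k ≤ s k ∧ s k ≤ t (k + 1) ∧ (t (k + 1) : ℝ) - t k < δ) →
    ‖∑ k ∈ Finset.range N, f (γ (s k)) * (γ (t (k + 1)) - γ (t k)) - I‖ < ε

/-- The integral of a complex function against a complex measure. -/
def cintegral (ν : ComplexMeasure ℂ) (φ : ℂ → ℂ) : ℂ :=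
  VectorMeasure.integral ν φ (ContinuousLinearMap.mul ℝ ℂ)

/-- The closed support of a complex measure, i.e. the support of its total variation `|ν|`. -/
def csupport (ν : ComplexMeasure ℂ) : Set ℂ :=
  (VectorMeasure.variation ν).support

/-- The Cauchy transform `f_ν(z) = (1 / 2πi) ∫ dν(t) / (z - t)`. -/
def cauchyTransform (ν : ComplexMeasure ℂ) (z : ℂ) : ℂ :=
  (2 * Real.pi * Complex.I)⁻¹ * cintegral ν (fun t => (z - t)⁻¹)

/-- Weak convergence `ν_n → μ`, tested on continuous functions with compact support. -/
def TendstoWeakly (ν : ℕ → ComplexMeasure ℂ) (μ : ComplexMeasure ℂ) : Prop :=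
  ∀ φ : ℂ → ℂ, Continuous φ → HasCompactSupport φ →
    Tendsto (fun n => cintegral (ν n) φ) atTop (𝓝 (cintegral μ φ))

/-- Convergence of sets in the Hausdorff distance. -/
def TendstoHausdorff (S : ℕ → Set ℂ) (K : Set ℂ) : Prop :=
  Tendsto (fun n => Metric.hausdorffEDist (S n) K) atTop (𝓝 0)

/-- The poles of a rational function in the finite plane (`RatFunc.denom` is the denominator of the
reduced fraction). -/
def ratPoles (R : RatFunc ℂ) : Finset ℂ :=
  R.denom.roots.toFinset

/-- The residue of a rational function at `ρ`: the coefficient of `(z - ρ)⁻¹` in its Laurent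
expansion at `ρ`. -/
def ratResidue (R : RatFunc ℂ) (ρ : ℂ) : ℂ :=
  ((RatFunc.laurent ρ R : RatFunc ℂ) : LaurentSeries ℂ).coeff (-1)

/-- The polar measure `μ_R = ∑_ρ (Res_ρ R) δ_ρ`. -/
def polarMeasure (R : RatFunc ℂ) : ComplexMeasure ℂ :=
  ∑ ρ ∈ ratPoles R, VectorMeasure.dirac ρ (ratResidue R ρ)

/-- A rational function as a function on the plane. -/
def ratFun (R : RatFunc ℂ) (z : ℂ) : ℂ :=
  RatFunc.eval (RingHom.id ℂ) z R

/-- An asymptotically holomorphic sequence of rational functions on `γ`: the polar measures have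
total mass bounded by some `M`, the poles are simple and lie off `γ`, and the polar mass of the
`ε`-neighbourhood of `γ` is asymptotically negligible:
`lim_{ε → 0} limsup_n |μ_{R_n}(V_ε(γ))| = 0`. -/
structure IsAsymptoticallyHolomorphic {z₀ z₁ : ℂ} (γ : Path z₀ z₁) (R : ℕ → RatFunc ℂ) : Prop where
  bounded : ∃ M : NNReal, ∀ n, VectorMeasure.variation (polarMeasure (R n)) univ ≤ M
  simple : ∀ n, Squarefree (R n).denom
  off : ∀ n, ∀ ρ ∈ ratPoles (R n), ρ ∉ range γ
  negligible : Tendsto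
    (fun ε : ℝ => limsup (fun n => ‖polarMeasure (R n) (Metric.thickening ε (range γ))‖ₑ) atTop)
    (𝓝[>] 0) (𝓝 0)

/-- `f` is an asymptotically holomorphic sequence on `γ` of rational functions, vanishing at
infinity, which approximates the Cauchy transform of `μ`. A rational function `R` with simple poles
which vanishes at infinity is the Cauchy transform of `2πi μ_R`, so the convergence required is that
of the measures `2πi μ_{f_n}` to `μ`, together with their supports. -/
def IsRationalApproximation {z₀ z₁ : ℂ} (γ : Path z₀ z₁) (μ : ComplexMeasure ℂ)
    (f : ℕ → ℂ → ℂ) : Prop :=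
  ∃ R : ℕ → RatFunc ℂ,
    IsAsymptoticallyHolomorphic γ R ∧
    (∀ n, (R n).num.degree < (R n).denom.degree) ∧
    TendstoWeakly (fun n => (2 * Real.pi * Complex.I : ℂ) • polarMeasure (R n)) μ ∧
    TendstoHausdorff (fun n => csupport (polarMeasure (R n))) (csupport μ) ∧
    ∀ n, f n = ratFun (R n)

/-- `f` is a sequence of Cauchy transforms of complex measures `ν_n` of uniformly bounded total
variation with `ν_n → μ` weakly and `supp ν_n → supp μ`, the integrals that define `f_n` on `γ` being
absolutely convergent (with `1 / 0 = ∞` in the integrand). -/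
def IsCauchyApproximation {z₀ z₁ : ℂ} (γ : Path z₀ z₁) (μ : ComplexMeasure ℂ)
    (f : ℕ → ℂ → ℂ) : Prop :=
  ∃ ν : ℕ → ComplexMeasure ℂ,
    (∃ M : NNReal, ∀ n, VectorMeasure.variation (ν n) univ ≤ M) ∧
    (∀ n, ∀ z ∈ range γ, ∫⁻ t, ‖z - t‖ₑ⁻¹ ∂(VectorMeasure.variation (ν n)) < ⊤) ∧
    TendstoWeakly ν μ ∧
    TendstoHausdorff (fun n => csupport (ν n)) (csupport μ) ∧
    ∀ n, f n = cauchyTransform (ν n)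

/-- `w` is the (finite) Borel extension at `z₁` along `γ` of the holomorphic germ `F : U → ℂ` at
`z₀`, for the approximating sequence `(fₙ)`: the `fₙ` converge uniformly on `γ` to a continuous
function `f` that coincides with `F'` on `U`, and
`w - F(z₀) = ∫_γ f(t) dt = lim ∫_γ fₙ(t) dt`. -/
def IsBorelExtension {z₀ z₁ : ℂ} (γ : Path z₀ z₁) (U : Set ℂ) (F : ℂ → ℂ) (fn : ℕ → ℂ → ℂ)
    (w : ℂ) : Prop :=
  ∃ f : ℂ → ℂ,
    ContinuousOn f (range γ) ∧
    TendstoUniformlyOn fn f atTop (range γ) ∧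
    (∀ z ∈ U ∩ range γ, f z = deriv F z) ∧
    HasPathIntegral γ f (w - F z₀) ∧
    ∃ J : ℕ → ℂ, (∀ᶠ n in atTop, HasPathIntegral γ (fn n) (J n)) ∧
      Tendsto J atTop (𝓝 (w - F z₀))

end

/-! Perturbation lemma. By Eilenberg's criterion, a closed set `X` with bounded complement separates
`p` from `q` unless `(z - p) / (z - q)` has a continuous logarithm on `X`. On arcs and on compact
totally disconnected sets every nonvanishing continuous function has a logarithm, and logarithms on
two closed sets glue when the intersection is connected (`mem_connectedComponentIn_compl_union`).
Hence a thin neighbourhood of `γ` stays connected after `γ` and then `K` are removed, and near an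
endpoint of `γ` this complement is locally connected, so both endpoints are accessible from it
(`exists_joinedIn_insert`). This yields a path from `z₀` to `z₁` that avoids `γ` and `K` except
possibly at `z₀` and `z₁`. It contains an arc `η` (`Path.exists_injective`), `η ∪ γ` is a Jordan
curve, and `η` is Hausdorff-close to `γ` because an arc almost returns to a point only by staying
near it (`exists_thickening_hausdorffDist_lt`).

Independence of the sequence. At a point off `K`, the Cauchy kernel can be cut off to a test
function, so weak convergence together with convergence of supports forces `fₙ → f_μ` there;
rational functions fit in by partial fractions. Since `K` is totally disconnected and `γ` injective,
the parameters `t` with `γ t ∉ K` are dense. The continuous uniform limits of two sequences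
therefore agree on all of `γ`, and so do their integrals. -/

noncomputable section

/-! ### Continuous logarithms and separation of points in the plane -/

/-- Every continuous nonvanishing complex function on `X` has a continuous logarithm. -/
def HasLogarithms (X : Set ℂ) : Prop :=
  ∀ f : ℂ → ℂ, ContinuousOn f X → (∀ z ∈ X, f z ≠ 0) →
    ∃ g : ℂ → ℂ, ContinuousOn g X ∧ ∀ z ∈ X, Complex.exp (g z) = f z

/-- The function `(z - p) / (z - q)` has a continuous logarithm on `X`. -/
def HasLogRatio (X : Set ℂ) (p q : ℂ) : Prop :=
  ∃ g : ℂ → ℂ, ContinuousOn g X ∧ ∀ z ∈ X, Complex.exp (g z) = (z - p) / (z - q)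

theorem HasLogarithms.hasLogRatio {X : Set ℂ} (h : HasLogarithms X) {p q : ℂ} (hp : p ∉ X)
    (hq : q ∉ X) : HasLogRatio X p q := by
  have h1 : ∀ z ∈ X, z - q ≠ 0 := fun z hz h0 => hq (by rwa [← sub_eq_zero.1 h0])
  have h2 : ∀ z ∈ X, z - p ≠ 0 := fun z hz h0 => hp (by rwa [← sub_eq_zero.1 h0])
  refine h _ ?_ fun z hz => div_ne_zero (h2 z hz) (h1 z hz)
  exact ContinuousOn.div (by fun_prop) (by fun_prop) h1

theorem HasLogRatio.mono {X Y : Set ℂ} {p q : ℂ} (h : HasLogRatio X p q) (hY : Y ⊆ X) :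
    HasLogRatio Y p q := by
  obtain ⟨g, hg, he⟩ := h
  exact ⟨g, hg.mono hY, fun z hz => he z (hY hz)⟩

theorem HasLogRatio.symm {X : Set ℂ} {p q : ℂ} (h : HasLogRatio X p q) : HasLogRatio X q p := by
  obtain ⟨g, hg, he⟩ := h
  refine ⟨fun z => -g z, hg.neg, fun z hz => ?_⟩
  rw [Complex.exp_neg, he z hz, inv_div]

theorem HasLogRatio.trans {X : Set ℂ} {p q r : ℂ} (hq : q ∉ X) (h : HasLogRatio X p q)
    (h' : HasLogRatio X q r) : HasLogRatio X p r := by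
  obtain ⟨g, hg, he⟩ := h
  obtain ⟨g', hg', he'⟩ := h'
  refine ⟨fun z => g z + g' z, hg.add hg', fun z hz => ?_⟩
  have h1 : z - q ≠ 0 := fun h0 => hq (by rwa [← sub_eq_zero.1 h0])
  rw [Complex.exp_add, he z hz, he' z hz, div_mul_div_cancel₀ h1]

/-- The quotient is `1 + (p - q) / (z - p)`, where the second term has norm less than 1, so the
principal branch applies. -/
theorem hasLogRatio_of_ball {X : Set ℂ} {p q : ℂ} {r : ℝ} (h : Disjoint (Metric.ball p r) X)
    (hq : q ∈ Metric.ball p r) : HasLogRatio X q p := by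
  have hr : 0 < r := dist_nonneg.trans_lt hq
  have h1 : ∀ z ∈ X, r ≤ ‖z - p‖ := fun z hz => by
    by_contra hlt
    exact disjoint_left.1 h (by simpa [dist_eq_norm] using hlt) hz
  have h0 : ∀ z ∈ X, z - p ≠ 0 := fun z hz hz0 => by
    have := h1 z hz
    rw [hz0, norm_zero] at this
    linarith
  have hs : ∀ z ∈ X, (z - q) / (z - p) ∈ Complex.slitPlane := fun z hz => by
    have h2 : (z - q) / (z - p) = 1 + (p - q) / (z - p) := by
      have := h0 z hz
      field_simp
      ring
    rw [h2]
    apply Complex.mem_slitPlane_of_norm_lt_one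
    rw [norm_div, div_lt_one (hr.trans_le (h1 z hz))]
    rw [mem_ball_iff_norm, norm_sub_rev] at hq
    exact hq.trans_le (h1 z hz)
  refine ⟨fun z => Complex.log ((z - q) / (z - p)), ?_, fun z hz =>
    Complex.exp_log (Complex.slitPlane_ne_zero (hs z hz))⟩
  exact (ContinuousOn.div (by fun_prop) (by fun_prop) h0).clog hs

theorem hasLogRatio_of_isPreconnected {A C : Set ℂ} (hA : IsClosed A) (hC : IsPreconnected C)
    (hCA : Disjoint C A) {p q : ℂ} (hp : p ∈ C) (hq : q ∈ C) : HasLogRatio A p q := by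
  refine hC.induction₂ (fun x y => HasLogRatio A x y) (fun x hx => ?_)
    (fun x y z _ hy _ h1 h2 => h1.trans (disjoint_left.1 hCA hy) h2) (fun x y _ _ h => h.symm) hp hq
  obtain ⟨r, hr, hb⟩ := Metric.isOpen_iff.1 hA.isOpen_compl x (disjoint_left.1 hCA hx)
  refine mem_nhdsWithin_of_mem_nhds (mem_of_superset (Metric.ball_mem_nhds x hr) fun y hy => ?_)
  exact (hasLogRatio_of_ball (disjoint_left.2 fun z hz => hb hz) hy).symm

/-- The difference divided by `2πi` is continuous and integer-valued on a preconnected set. -/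
theorem exists_const_of_exp_eq {A : Set ℂ} (hA : IsPreconnected A) {f g : ℂ → ℂ}
    (hf : ContinuousOn f A) (hg : ContinuousOn g A)
    (h : ∀ z ∈ A, Complex.exp (f z) = Complex.exp (g z)) :
    ∃ c, Complex.exp c = 1 ∧ ∀ z ∈ A, f z = g z + c := by
  rcases A.eq_empty_or_nonempty with rfl | ⟨a, ha⟩
  · exact ⟨0, by simp, by simp⟩
  refine ⟨f a - g a, by rw [Complex.exp_sub, h a ha, div_self (Complex.exp_ne_zero _)],
    fun z hz => ?_⟩
  have hk : ∀ z ∈ A, ∃ n : ℤ, f z = g z + n * (2 * Real.pi * Complex.I) := fun z hz =>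
    Complex.exp_eq_exp_iff_exists_int.1 (h z hz)
  have hpi : (2 * Real.pi * Complex.I : ℂ) ≠ 0 := Complex.two_pi_I_ne_zero
  choose! n hn using hk
  have hc : ContinuousOn (fun z => ((f z - g z) / (2 * Real.pi * Complex.I)).re) A :=
    Complex.continuous_re.comp_continuousOn ((hf.sub hg).div_const _)
  have hn' : ∀ z ∈ A, ((f z - g z) / (2 * Real.pi * Complex.I)).re = (n z : ℝ) := fun z hz => by
    rw [hn z hz, add_sub_cancel_left, mul_div_cancel_right₀ _ hpi]
    simp
  have hc' : ContinuousOn n A := by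
    have : ContinuousOn (fun z => (n z : ℝ)) A := hc.congr fun z hz => (hn' z hz).symm
    exact (Int.isClosedEmbedding_coe_real.isInducing.continuousOn_iff).2 this
  have := hA.constant hc' hz ha
  rw [hn z hz, hn a ha, this]
  ring

/-- On the preconnected overlap the two logarithms differ by a constant period; shifting one of them
by it makes them glue. -/
theorem HasLogRatio.union {A B : Set ℂ} (hA : IsClosed A) (hB : IsClosed B)
    (hAB : IsPreconnected (A ∩ B)) {p q : ℂ} (h : HasLogRatio A p q) (h' : HasLogRatio B p q) :
    HasLogRatio (A ∪ B) p q := by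
  classical
  obtain ⟨f, hf, he⟩ := h
  obtain ⟨g, hg, he'⟩ := h'
  obtain ⟨c, hc, hfg⟩ := exists_const_of_exp_eq hAB (hf.mono inter_subset_left)
    (hg.mono inter_subset_right) fun z hz => (he z hz.1).trans (he' z hz.2).symm
  refine ⟨fun z => if z ∈ A then f z else g z + c, ?_, ?_⟩
  · apply ContinuousOn.union_of_isClosed _ _ hA hB
    · exact hf.congr fun z hz => if_pos hz
    · refine (hg.add (continuousOn_const (c := c))).congr fun z hz => ?_
      by_cases hzA : z ∈ A
      · simpa [hzA] using hfg z ⟨hzA, hz⟩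
      · simp [hzA]
  · rintro z hz
    by_cases hzA : z ∈ A
    · simpa [hzA] using he z hzA
    · have hzB : z ∈ B := hz.resolve_left hzA
      simp [hzA, Complex.exp_add, hc, he' z hzB]

theorem exists_log_of_continuous {X : Type*} [TopologicalSpace X] [LocallyPathConnectedSpace X]
    [ContractibleSpace X] {H : X → ℂ} (hH : Continuous H) (h0 : ∀ z, H z ≠ 0) :
    ∃ L : X → ℂ, Continuous L ∧ ∀ z, Complex.exp (L z) = H z := by
  obtain ⟨L, hL, he⟩ := Complex.exists_continuousOn_eqOn_exp_comp (X := X) (U := univ) (g := H)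
    (by
      have := (Homeomorph.Set.univ X).contractibleSpace
      exact inferInstanceAs (SimplyConnectedSpace (univ : Set X))) isOpen_univ
    hH.continuousOn (by rintro ⟨z, -, hz⟩; exact h0 z hz)
  exact ⟨L, by simpa using hL, fun z => he (mem_univ z)⟩

theorem no_log_on_circle {L : ℂ → ℂ} (hL : Continuous L) (p : ℂ) {R : ℝ} (hR : 0 < R)
    (h : ∀ z, ‖z - p‖ = R → Complex.exp (L z) = z - p) : False := by
  have hc : ∀ θ : ℝ, Complex.exp (L (p + R * Complex.exp (θ * Complex.I)))
      = R * Complex.exp (θ * Complex.I) := fun θ => by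
    rw [h _ (by simp [Complex.norm_exp_ofReal_mul_I, abs_of_pos hR])]
    ring
  -- The angle is read as the real part of a complex variable, so that uniqueness of logarithms on
  -- subsets of `ℂ` applies to the real line. The comparison with `log R + iθ` then fails at `θ = 0`
  -- and `θ = 2π`.
  have hcont : Continuous fun z : ℂ => L (p + R * Complex.exp (z.re * Complex.I)) := by fun_prop
  obtain ⟨c, -, hc'⟩ := exists_const_of_exp_eq (A := range ((↑) : ℝ → ℂ))
    (isPreconnected_range Complex.continuous_ofReal)
    (f := fun z : ℂ => L (p + R * Complex.exp (z.re * Complex.I)))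
    (g := fun z => Real.log R + z * Complex.I) hcont.continuousOn (by fun_prop) (by
      rintro _ ⟨θ, rfl⟩
      simp only [Complex.ofReal_re]
      rw [hc, Complex.exp_add, ← Complex.ofReal_exp, Real.exp_log hR])
  have h1 := hc' _ ⟨0, rfl⟩
  have h2 := hc' _ ⟨2 * Real.pi, rfl⟩
  simp only [Complex.ofReal_re] at h1 h2
  have h3 : Complex.exp (((2 * Real.pi : ℝ) : ℂ) * Complex.I)
      = Complex.exp (((0 : ℝ) : ℂ) * Complex.I) := by
    push_cast
    rw [Complex.exp_two_pi_mul_I]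
    simp
  rw [h3, h1] at h2
  have : ((2 * Real.pi : ℝ) : ℂ) * Complex.I = 0 := by
    have := sub_eq_zero.2 h2
    simp only [Complex.ofReal_zero, zero_mul, add_zero] at this
    linear_combination -this
  push_cast at this
  exact Complex.two_pi_I_ne_zero this

/-- Extend a logarithm on the frontier by Tietze to `G`. Then `exp G * (z - q)` on the closure and
`z - p` outside glue to a nonvanishing function on the plane, which has a logarithm; on a large
circle that would be a logarithm of `z - p`. -/
theorem not_hasLogRatio_frontier {U : Set ℂ} (hb : Bornology.IsBounded U) {p q : ℂ}
    (hp : p ∈ U) (hq : q ∉ closure U) : ¬ HasLogRatio (frontier U) p q := by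
  classical
  rintro ⟨g, hg, he⟩
  obtain ⟨G, hG⟩ := ContinuousMap.exists_restrict_eq (Y := ℂ) (isClosed_frontier (s := U))
    ⟨_, hg.domRestrict⟩
  have hG' : ∀ z ∈ frontier U, G z = g z := fun z hz => congrArg (fun f => f ⟨z, hz⟩) hG
  have hpf : ∀ z, z ∉ U → z ≠ p := fun z hz h => hz (h ▸ hp)
  have hqf : ∀ z ∈ closure U, z - q ≠ 0 := fun z hz h => hq (by rwa [← sub_eq_zero.1 h])
  let H : ℂ → ℂ := fun z => if z ∈ closure U then Complex.exp (G z) * (z - q) else z - p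
  have hH : Continuous H := by
    refine Continuous.if (fun z hz => ?_) (by fun_prop) (by fun_prop)
    have hz : z ∈ frontier U := frontier_closure_subset hz
    rw [hG' z hz, he z hz, div_mul_cancel₀ _ (hqf z (frontier_subset_closure hz))]
  have hH0 : ∀ z, H z ≠ 0 := fun z => by
    by_cases hz : z ∈ closure U
    · simpa [H, hz, Complex.exp_ne_zero] using hqf z hz
    · simpa [H, hz, sub_eq_zero] using hpf z fun h => hz (subset_closure h)
  obtain ⟨L, hL, hLe⟩ := exists_log_of_continuous hH hH0
  obtain ⟨r, hr⟩ := hb.closure.subset_closedBall p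
  refine no_log_on_circle hL p (R := max r 0 + 1) (by positivity) fun z hz => ?_
  have hzU : z ∉ closure U := fun h => by
    have h1 := hr h
    rw [mem_closedBall_iff_norm, hz] at h1
    linarith [le_max_left r 0]
  rw [hLe]
  simp [H, hzU]

/-- The component of `p` is open, bounded, and relatively closed in `Xᶜ`, so its frontier lies in
`X`; if it missed `q`, the previous obstruction would apply. -/
theorem mem_connectedComponentIn_of_hasLogRatio {X : Set ℂ} (hX : IsClosed X)
    (hb : Bornology.IsBounded Xᶜ) {p q : ℂ} (hp : p ∉ X) (hq : q ∉ X) (h : HasLogRatio X p q) :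
    q ∈ connectedComponentIn Xᶜ p := by
  by_contra hqU
  have hUo : IsOpen (connectedComponentIn Xᶜ p) := hX.isOpen_compl.connectedComponentIn
  have hsub : ∀ z ∈ closure (connectedComponentIn Xᶜ p), z ∉ X →
      z ∈ connectedComponentIn Xᶜ p := fun z hz hzX => by
    have h1 : IsPreconnected (insert z (connectedComponentIn Xᶜ p)) :=
      isPreconnected_connectedComponentIn.subset_closure (subset_insert _ _)
        (insert_subset hz subset_closure)
    exact h1.subset_connectedComponentIn (mem_insert_of_mem _ (mem_connectedComponentIn hp))
      (insert_subset hzX (connectedComponentIn_subset _ _)) (mem_insert _ _)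
  refine not_hasLogRatio_frontier (hb.subset (connectedComponentIn_subset _ _))
    (mem_connectedComponentIn hp) (fun hc => hqU (hsub q hc hq)) (h.mono fun z hz => ?_)
  by_contra hzX
  rw [hUo.frontier_eq] at hz
  exact hz.2 (hsub z hz.1 hzX)

/-- A case of Janiszewski's theorem: two closed sets with preconnected intersection, neither of
which separates `p` from `q`, do not separate them together. -/
theorem mem_connectedComponentIn_compl_union {A B C : Set ℂ} (hA : IsClosed A) (hB : IsClosed B)
    (hb : Bornology.IsBounded Aᶜ) (hBl : HasLogarithms B) (hAB : IsPreconnected (A ∩ B))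
    (hC : IsPreconnected C) (hCA : Disjoint C A) {p q : ℂ} (hpC : p ∈ C) (hqC : q ∈ C)
    (hp : p ∉ B) (hq : q ∉ B) : q ∈ connectedComponentIn (A ∪ B)ᶜ p := by
  have hpA := disjoint_left.1 hCA hpC
  have hqA := disjoint_left.1 hCA hqC
  refine mem_connectedComponentIn_of_hasLogRatio (hA.union hB)
    (hb.subset (compl_subset_compl.2 subset_union_left)) (fun h => h.elim hpA hp)
    (fun h => h.elim hqA hq) ?_
  exact (hasLogRatio_of_isPreconnected hA hC hCA hpC hqC).union hA hB hAB (hBl.hasLogRatio hp hq)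

theorem hasLogarithms_range {φ : unitInterval → ℂ} (hφ : Continuous φ)
    (hi : Function.Injective φ) : HasLogarithms (range φ) := by
  intro f hf h0
  obtain ⟨L', hL', he'⟩ := exists_log_of_continuous
    (H := fun x : ℝ => f (φ (projIcc 0 1 zero_le_one x)))
    (hf.comp_continuous (hφ.comp continuous_projIcc) fun t => mem_range_self _)
    fun t => h0 _ (mem_range_self _)
  let L : unitInterval → ℂ := fun t => L' t
  have hL : Continuous L := hL'.comp continuous_subtype_val
  have he : ∀ t, Complex.exp (L t) = f (φ t) := fun t => by simp [L, he']
  have hemb : IsClosedEmbedding φ := hφ.isClosedEmbedding hi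
  refine ⟨fun z => L (Function.invFun φ z), ?_, ?_⟩
  · rw [continuousOn_iff_continuous_domRestrict]
    let e : unitInterval ≃ₜ range φ := hemb.isEmbedding.toHomeomorph
    refine (hL.comp e.symm.continuous).congr fun z => ?_
    obtain ⟨t, rfl⟩ := e.surjective z
    have : ((e t : range φ) : ℂ) = φ t := rfl
    simp [this, Function.leftInverse_invFun hi t]
  · rintro _ ⟨t, rfl⟩
    simp [Function.leftInverse_invFun hi t, he]

/-- A locally constant function `h ∘ g` with finitely many values approximates `f` so well that the
quotient stays in the slit plane; the logarithms of quotient and approximant are continuous and add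
up. -/
theorem hasLogarithms_of_isTotallyDisconnected {K : Set ℂ} (hK : IsCompact K)
    (hd : IsTotallyDisconnected K) : HasLogarithms K := by
  classical
  intro f hf h0
  have : CompactSpace K := isCompact_iff_compactSpace.1 hK
  have : TotallyDisconnectedSpace K := (totallyDisconnectedSpace_subtype_iff).2 hd
  let F : C(K, {z : ℂ // z ≠ 0}) :=
    ⟨fun z => ⟨f z, h0 z z.2⟩, (continuousOn_iff_continuous_domRestrict.1 hf).subtype_mk _⟩
  let S : Set ({z : ℂ // z ≠ 0} × {z : ℂ // z ≠ 0}) :=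
    {x | (x.1 : ℂ) / x.2 ∈ Complex.slitPlane}
  have hS : S ∈ nhdsSet (diagonal {z : ℂ // z ≠ 0}) := by
    refine IsOpen.mem_nhdsSet (IsOpen.preimage ?_ Complex.isOpen_slitPlane) |>.2 ?_
    · exact Continuous.div (by fun_prop) (by fun_prop) fun x => x.2.2
    · rintro ⟨x, y⟩ hxy
      obtain rfl : x = y := hxy
      simp [div_self x.2]
  obtain ⟨n, g, h, hg, hS'⟩ := ContinuousMap.exists_finite_approximation_of_mem_nhds_diagonal F hS
  let G : K → ℂ := fun z => Complex.log (f z / h (g z)) + Complex.log (h (g z))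
  have hG : Continuous G := by
    have h1 : Continuous fun z => ((h (g z) : {z : ℂ // z ≠ 0}) : ℂ) :=
      (continuous_of_discreteTopology (f := fun i => ((h i : {z : ℂ // z ≠ 0}) : ℂ))).comp hg
    have h2 : Continuous fun z => Complex.log ((h (g z) : {z : ℂ // z ≠ 0}) : ℂ) :=
      (continuous_of_discreteTopology
        (f := fun i => Complex.log ((h i : {z : ℂ // z ≠ 0}) : ℂ))).comp hg
    refine Continuous.add ?_ h2
    exact ((continuousOn_iff_continuous_domRestrict.1 hf).div h1 fun z => (h (g z)).2).clog hS'
  refine ⟨fun z => if hz : z ∈ K then G ⟨z, hz⟩ else 0, ?_, fun z hz => ?_⟩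
  · rw [continuousOn_iff_continuous_domRestrict]
    refine hG.congr fun z => ?_
    simp
  · simp only [hz, dite_true, G]
    rw [Complex.exp_add, Complex.exp_log (div_ne_zero (h0 z hz) (h _).2),
      Complex.exp_log (h _).2, div_mul_cancel₀ _ (h _).2]

end

noncomputable section

/-! ### Connectedness of complements of arcs and of totally disconnected sets -/

theorem exists_isClopen_between {K P V : Set ℂ} (hK : IsCompact K) (hd : IsTotallyDisconnected K)
    (hP : IsCompact P) (hV : IsOpen V) (hPV : P ⊆ V) :
    ∃ L ⊆ K, IsCompact L ∧ IsCompact (K \ L) ∧ K ∩ P ⊆ L ∧ L ⊆ V := by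
  have : CompactSpace K := isCompact_iff_compactSpace.1 hK
  have : TotallyDisconnectedSpace K := (totallyDisconnectedSpace_subtype_iff).2 hd
  obtain ⟨C, hC, hPC, hCV⟩ := exists_clopen_of_closed_subset_open (X := K)
    (hP.isClosed.preimage continuous_subtype_val) (hV.preimage continuous_subtype_val)
    (preimage_mono hPV)
  refine ⟨(↑) '' C, by simp, hC.isClosed.isCompact.image continuous_subtype_val, ?_, ?_, ?_⟩
  · have h : K \ (↑) '' C = ((↑) : K → ℂ) '' Cᶜ := by
      rw [image_compl_eq_range_sdiff_image Subtype.val_injective, Subtype.range_coe]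
    rw [h]
    exact hC.compl.isClosed.isCompact.image continuous_subtype_val
  · rintro z ⟨hz, hzP⟩
    exact ⟨⟨z, hz⟩, hPC hzP, rfl⟩
  · rintro _ ⟨z, hz, rfl⟩
    exact hCV hz

theorem IsPreconnected.diff_of_isTotallyDisconnected {V K : Set ℂ} (hV : IsPreconnected V)
    (hVo : IsOpen V) (hVb : Bornology.IsBounded V) (hK : IsCompact K)
    (hd : IsTotallyDisconnected K) : IsPreconnected (V \ K) := by
  refine isPreconnected_of_forall_pair fun p hp q hq => ?_
  obtain ⟨γ, hγ⟩ := ((hVo.isConnected_iff_isPathConnected).1 ⟨⟨p, hp.1⟩, hV⟩).joinedIn p hp.1 q hq.1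
  -- `L` is the part of `K` near a path from `p` to `q` in `V`. The rest of `K`, together with `Vᶜ`,
  -- misses both the path and `L`, so adding `L` does not separate `p` from `q`.
  obtain ⟨L, hLK, hL, hKL, hPL, hLV⟩ := exists_isClopen_between hK hd
    (isCompact_range γ.continuous) hVo (range_subset_iff.2 hγ)
  have hU : Vᶜ ∪ K \ L ∪ L = (V \ K)ᶜ := by
    rw [union_assoc, sdiff_union_of_subset hLK, Set.sdiff_eq, compl_inter, compl_compl]
  have key := mem_connectedComponentIn_compl_union (A := Vᶜ ∪ K \ L) (B := L) (C := range γ)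
    (p := p) (q := q)
    (hVo.isClosed_compl.union hKL.isClosed) hL.isClosed
    (hVb.subset (by rw [compl_union, compl_compl]; exact inter_subset_left))
    (hasLogarithms_of_isTotallyDisconnected hL (fun t ht => hd t (ht.trans hLK))) ?_
    (isPreconnected_range γ.continuous) ?_ ⟨0, γ.source⟩ ⟨1, γ.target⟩
    (fun h => hp.2 (hLK h)) (fun h => hq.2 (hLK h))
  · rw [hU, compl_compl] at key
    exact ⟨_, connectedComponentIn_subset _ _, mem_connectedComponentIn hp, key,
      isPreconnected_connectedComponentIn⟩
  · have : (Vᶜ ∪ K \ L) ∩ L = ∅ := by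
      ext z
      simp only [mem_inter_iff, mem_union, mem_compl_iff, Set.mem_sdiff, mem_empty_iff_false, iff_false]
      rintro ⟨h | h, hz⟩
      exacts [h (hLV hz), h.2 hz]
    rw [this]
    exact isPreconnected_empty
  · rw [disjoint_left]
    rintro _ ⟨t, rfl⟩ (h | h)
    exacts [h (hγ t), h.2 (hPL ⟨h.1, mem_range_self t⟩)]

theorem isPreconnected_diff_range {φ : unitInterval → ℂ} (hφ : Continuous φ)
    (hi : Function.Injective φ) {W : Set ℂ} (hW : IsPreconnected W) (hWo : IsOpen W)
    (hWb : Bornology.IsBounded W) (hr : range φ ⊆ W) : IsPreconnected (W \ range φ) := by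
  refine isPreconnected_of_forall_pair fun p hp q hq => ?_
  have hU : Wᶜ ∪ range φ = (W \ range φ)ᶜ := by
    rw [Set.sdiff_eq, compl_inter, compl_compl]
  have key := mem_connectedComponentIn_compl_union (A := Wᶜ) (B := range φ) (C := W)
    (p := p) (q := q) hWo.isClosed_compl (isCompact_range hφ).isClosed (by rwa [compl_compl])
    (hasLogarithms_range hφ hi) (by
      rw [(disjoint_compl_left_iff_subset.2 hr).inter_eq]; exact isPreconnected_empty)
    hW disjoint_compl_right hp.1 hq.1 hp.2 hq.2
  rw [hU, compl_compl] at key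
  exact ⟨_, connectedComponentIn_subset _ _, mem_connectedComponentIn hp, key,
    isPreconnected_connectedComponentIn⟩

theorem IsPreconnected.thickening {S : Set ℂ} (hS : IsPreconnected S) (δ : ℝ) :
    IsPreconnected (Metric.thickening δ S) := by
  refine isPreconnected_of_forall_pair fun p hp q hq => ?_
  obtain ⟨x, hx, hpx⟩ := Metric.mem_thickening_iff.1 hp
  obtain ⟨y, hy, hqy⟩ := Metric.mem_thickening_iff.1 hq
  have hδ : 0 < δ := dist_nonneg.trans_lt hpx
  refine ⟨Metric.ball x δ ∪ S ∪ Metric.ball y δ, ?_, Or.inl (Or.inl hpx), Or.inr hqy, ?_⟩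
  · refine union_subset (union_subset ?_ (Metric.self_subset_thickening hδ S)) ?_
    exacts [Metric.ball_subset_thickening hx δ, Metric.ball_subset_thickening hy δ]
  · refine IsPreconnected.union y (Or.inr hy) (Metric.mem_ball_self hδ) ?_
      (convex_ball _ _).isPreconnected
    exact IsPreconnected.union x (Metric.mem_ball_self hδ) hx (convex_ball _ _).isPreconnected hS

/-- The complement of an arc is locally connected at the endpoints of the arc. -/
theorem exists_ball_joinedIn {φ : unitInterval → ℂ} (hφ : Continuous φ)
    (hi : Function.Injective φ) {K : Set ℂ} (hK : IsCompact K) (hd : IsTotallyDisconnected K)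
    {ε : ℝ} (hε : 0 < ε) :
    ∃ δ > 0, ∀ p ∈ (Metric.ball (φ 0) δ \ range φ) \ K,
      ∀ q ∈ (Metric.ball (φ 0) δ \ range φ) \ K,
        JoinedIn ((Metric.ball (φ 0) ε \ range φ) \ K) p q := by
  set W := Metric.ball (φ 0) ε
  obtain ⟨t₁, ht₁, hball⟩ : ∃ t₁ : unitInterval, 0 < t₁ ∧ ∀ t ≤ t₁, φ t ∈ W := by
    have h1 : φ ⁻¹' W ∈ 𝓝 (0 : unitInterval) :=
      hφ.continuousAt (Metric.ball_mem_nhds (φ 0) hε)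
    obtain ⟨r, hr, hb⟩ := Metric.mem_nhds_iff.1 h1
    refine ⟨⟨min (r / 2) 1, by positivity, min_le_right _ _⟩, ?_, fun t ht => hb ?_⟩
    · rw [← Subtype.coe_lt_coe]
      simp [hr]
    · have h2 : (t : ℝ) ≤ min (r / 2) 1 := ht
      have h3 := t.2.1
      rw [Metric.mem_ball, Subtype.dist_eq, Real.dist_eq]
      rw [Icc.coe_zero, sub_zero, abs_of_nonneg h3]
      linarith [min_le_left (r / 2) 1]
  -- The arc is cut at `t₁`, before which it stays in `W`. The initial piece `ψ` meets `A` in one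
  -- point only, and a small ball about `φ 0` misses `A`, so the gluing criterion applies to points
  -- of that ball.
  let A : Set ℂ := φ '' Ici t₁ ∪ Wᶜ
  let ψ : unitInterval → ℂ := fun s => φ (s * t₁)
  have hψ : Continuous ψ := by fun_prop
  have hψi : Function.Injective ψ := fun s s' h =>
    mul_right_cancel₀ ht₁.ne' (hi h)
  have hψr : range ψ = φ '' Iic t₁ := by
    ext z
    constructor
    · rintro ⟨s, rfl⟩
      exact ⟨s * t₁, unitInterval.mul_le_right, rfl⟩
    · rintro ⟨t, ht, rfl⟩
      have h0 : (0 : ℝ) < t₁ := ht₁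
      refine ⟨⟨t / t₁, div_nonneg t.2.1 t₁.2.1, div_le_one_of_le₀ ht t₁.2.1⟩, ?_⟩
      refine congrArg φ (Subtype.ext ?_)
      simp [div_mul_cancel₀ _ h0.ne']
  have hAc : IsClosed A :=
    (isClosed_Ici.isCompact.image hφ).isClosed.union Metric.isOpen_ball.isClosed_compl
  have hAB : A ∩ range ψ = {φ t₁} := by
    rw [hψr]
    ext z
    constructor
    · rintro ⟨⟨t, ht, rfl⟩ | h, ⟨s, hs, hz⟩⟩
      · have hst : s = t := hi hz
        subst hst
        have hs' : s = t₁ := le_antisymm hs ht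
        rw [hs']
        rfl
      · exact absurd (hz ▸ hball s hs) h
    · rintro rfl
      exact ⟨Or.inl ⟨t₁, self_mem_Ici, rfl⟩, ⟨t₁, self_mem_Iic, rfl⟩⟩
  have hU : A ∪ range ψ = (W \ range φ)ᶜ := by
    have hA : A = Wᶜ ∪ φ '' Ici t₁ := union_comm _ _
    rw [hψr, Set.sdiff_eq, compl_inter, compl_compl, hA, union_assoc, ← image_union,
      Ici_union_Iic, image_univ]
  have h0A : φ 0 ∈ Aᶜ := by
    rintro (⟨t, ht, h⟩ | h)
    · rw [hi h] at ht
      exact absurd ht₁ (not_lt.2 ht)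
    · exact h (Metric.mem_ball_self hε)
  obtain ⟨δ, hδ, hδA⟩ := Metric.isOpen_iff.1 hAc.isOpen_compl _ h0A
  refine ⟨δ, hδ, fun p hp q hq => ?_⟩
  have hsub : range ψ ⊆ range φ := by
    rw [hψr]
    exact image_subset_range _ _
  have key := mem_connectedComponentIn_compl_union (A := A) (B := range ψ)
    (C := Metric.ball (φ 0) δ) (p := p) (q := q) hAc (isCompact_range hψ).isClosed
    (Metric.isBounded_ball.subset (by
      rw [compl_union, compl_compl]
      exact inter_subset_right)) (hasLogarithms_range hψ hψi)
    (by rw [hAB]; exact isPreconnected_singleton) (convex_ball _ _).isPreconnected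
    (disjoint_left.2 hδA) hp.1.1 hq.1.1 (fun h => hp.1.2 (hsub h)) (fun h => hq.1.2 (hsub h))
  rw [hU, compl_compl] at key
  have hopen : IsOpen (W \ range φ) :=
    Metric.isOpen_ball.sdiff (isCompact_range hφ).isClosed
  have hpW : p ∈ W \ range φ := connectedComponentIn_nonempty_iff.1 ⟨q, key⟩
  have hcomp : IsPreconnected (connectedComponentIn (W \ range φ) p \ K) :=
    isPreconnected_connectedComponentIn.diff_of_isTotallyDisconnected hopen.connectedComponentIn
      (Metric.isBounded_ball.subset ((connectedComponentIn_subset _ _).trans sdiff_subset)) hK hd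
  have hp' : p ∈ connectedComponentIn (W \ range φ) p \ K := ⟨mem_connectedComponentIn hpW, hp.2⟩
  exact ((((hopen.connectedComponentIn.sdiff hK.isClosed).isConnected_iff_isPathConnected).1
    ⟨⟨p, hp'⟩, hcomp⟩).joinedIn p hp' q ⟨key, hq.2⟩).mono
      (sdiff_subset_sdiff_left (connectedComponentIn_subset _ _))

/-! ### Empty interior of arcs and of totally disconnected sets -/

theorem not_subset_of_isTotallyDisconnected {K O : Set ℂ} (hd : IsTotallyDisconnected K)
    (hO : IsOpen O) (hne : O.Nonempty) : ¬ O ⊆ K := by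
  intro h
  obtain ⟨z, hz⟩ := hne
  obtain ⟨r, hr, hb⟩ := Metric.isOpen_iff.1 hO z hz
  have hs := hd _ (hb.trans h) (convex_ball z r).isPreconnected
  have h1 : z + (r / 2 : ℝ) ∈ Metric.ball z r := by
    rw [mem_ball_iff_norm, add_sub_cancel_left, Complex.norm_real, Real.norm_eq_abs, abs_of_pos] <;>
    linarith
  have := hs h1 (Metric.mem_ball_self hr)
  simp [hr.ne'] at this

/-- A disc stays connected when a point is removed, whereas an interval of parameters does not when
an interior point is removed. -/
theorem not_subset_range {φ : unitInterval → ℂ} (hφ : Continuous φ)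
    (hi : Function.Injective φ) {O : Set ℂ} (hO : IsOpen O) (hne : O.Nonempty) :
    ¬ O ⊆ range φ := by
  intro h
  have hind : IsInducing φ := (hφ.isClosedEmbedding hi).isInducing
  have hpre : ∀ S ⊆ O, IsPreconnected S → OrdConnected (φ ⁻¹' S) := fun S hS hp => by
    refine IsPreconnected.ordConnected (hind.isPreconnected_image.1 ?_)
    rwa [image_preimage_eq_of_subset (hS.trans h)]
  obtain ⟨z, hz⟩ := hne
  obtain ⟨r, hr, hb⟩ := Metric.isOpen_iff.1 hO z hz
  set B := Metric.ball z r
  have hinf : (φ ⁻¹' B).Infinite := by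
    have : B.Infinite := infinite_of_mem_nhds z (Metric.ball_mem_nhds z hr)
    intro hf
    refine this ((hf.image φ).subset ?_)
    rw [image_preimage_eq_of_subset (hb.trans h)]
  obtain ⟨a, ha⟩ := hinf.nonempty
  obtain ⟨b, hb', hab⟩ := (hinf.sdiff (finite_singleton a)).nonempty
  obtain ⟨c, hc, hcab⟩ := (hinf.sdiff ((finite_singleton b).insert a)).nonempty
  have hthree : ∃ x y t : unitInterval, x ∈ φ ⁻¹' B ∧ y ∈ φ ⁻¹' B ∧ x < t ∧ t < y := by
    simp only [mem_insert_iff, mem_singleton_iff, not_or] at hab hcab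
    rcases lt_or_gt_of_ne hab with h1 | h1
    · obtain ⟨t, h2, h3⟩ := exists_between h1
      exact ⟨b, a, t, hb', ha, h2, h3⟩
    · obtain ⟨t, h2, h3⟩ := exists_between h1
      exact ⟨a, b, t, ha, hb', h2, h3⟩
  obtain ⟨x, y, t, hx, hy, hxt, hty⟩ := hthree
  have := hpre (B \ {φ t}) (sdiff_subset.trans hb)
    ((convex_ball z r).isPreconnected.diff_of_isTotallyDisconnected Metric.isOpen_ball
      Metric.isBounded_ball isCompact_singleton isTotallyDisconnected_singleton)
  exact (this.out ⟨hx, fun h => hxt.ne (hi h)⟩ ⟨hy, fun h => hty.ne' (hi h)⟩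
    ⟨hxt.le, hty.le⟩).2 rfl

theorem diff_range_diff_nonempty {φ : unitInterval → ℂ} (hφ : Continuous φ)
    (hi : Function.Injective φ) {K : Set ℂ} (hK : IsCompact K) (hd : IsTotallyDisconnected K)
    {O : Set ℂ} (hO : IsOpen O) (hne : O.Nonempty) : ((O \ range φ) \ K).Nonempty := by
  have h1 : (O \ K).Nonempty := sdiff_nonempty.2 (not_subset_of_isTotallyDisconnected hd hO hne)
  obtain ⟨z, hz, hz'⟩ := sdiff_nonempty.2 (not_subset_range hφ hi (hO.sdiff hK.isClosed) h1)
  exact ⟨z, ⟨hz.1, hz'⟩, hz.2⟩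

end

noncomputable section

/-! ### Paths contain arcs -/

section Arc

variable {X : Type*} [MetricSpace X]

/-- A closed set of parameters containing the endpoints, such that `f` takes the same value at both
ends of each gap. -/
structure IsShortcutSet {Y : Type*} (f : unitInterval → Y) (S : Set unitInterval) : Prop where
  isClosed : IsClosed S
  zero_mem : 0 ∈ S
  one_mem : 1 ∈ S
  gap : ∀ a ∈ S, ∀ b ∈ S, a < b → Ioo a b ∩ S = ∅ → f a = f b

/-- The chain step for Zorn's lemma. Given a gap `(a, b)` of the intersection, compactness gives a
member `T` missing a slightly smaller `[a', b']`. The gap `(α, β)` of `T` around it has ends close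
to `a` and `b`, so `f a` and `f b` are within `ε`. -/
theorem IsShortcutSet.sInter {f : unitInterval → X} (hf : Continuous f)
    {c : Set (Set unitInterval)} (hne : c.Nonempty) (hc : ∀ S ∈ c, IsShortcutSet f S)
    (hch : IsChain (· ⊆ ·) c) : IsShortcutSet f (⋂₀ c) := by
  refine ⟨isClosed_sInter fun S hS => (hc S hS).isClosed, fun S hS => (hc S hS).zero_mem,
    fun S hS => (hc S hS).one_mem, fun a ha b hb hab hgap => ?_⟩
  refine eq_of_forall_dist_le fun ε hε => ?_
  have hε2 : 0 < ε / 2 := half_pos hε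
  obtain ⟨u, hu, hua⟩ := (mem_nhdsGE_iff_exists_mem_Ioc_Ico_subset hab).1
    (mem_nhdsWithin_of_mem_nhds (hf.continuousAt (Metric.ball_mem_nhds (f a) hε2)))
  obtain ⟨a', haa', ha'u⟩ := exists_between hu.1
  obtain ⟨l, hl, hlb⟩ := (mem_nhdsLE_iff_exists_mem_Ico_Ioc_subset (ha'u.trans_le hu.2)).1
    (mem_nhdsWithin_of_mem_nhds (hf.continuousAt (Metric.ball_mem_nhds (f b) hε2)))
  obtain ⟨b', hlb', hbb'⟩ := exists_between hl.2
  have : Nonempty c := hne.to_subtype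
  obtain ⟨⟨T, hTc⟩, hT⟩ := (isCompact_Icc (a := a') (b := b')).elim_directed_family_closed
    (fun S : c => (S : Set unitInterval)) (fun S => (hc S S.2).isClosed) (by
      rw [← sInter_eq_iInter, ← subset_empty_iff, ← hgap]
      exact inter_subset_inter_left _ fun x hx => ⟨haa'.trans_le hx.1, hx.2.trans_lt hbb'⟩)
    (by
      rintro ⟨S, hS⟩ ⟨T, hT⟩
      rcases hch.total hS hT with h | h
      exacts [⟨⟨S, hS⟩, subset_rfl, h⟩, ⟨⟨T, hT⟩, h, subset_rfl⟩])
  have hT' : ∀ x ∈ T, a' ≤ x → b' < x := fun x hx h1 => by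
    by_contra h2
    exact (hT ▸ (⟨⟨h1, not_lt.1 h2⟩, hx⟩ : x ∈ Icc a' b' ∩ T) : x ∈ (∅ : Set unitInterval))
  have haT := ha T hTc
  have hbT := hb T hTc
  obtain ⟨α, hα, hαm⟩ := ((hc T hTc).isClosed.inter isClosed_Iic).isCompact.exists_isGreatest
    (s := T ∩ Iic a') ⟨a, haT, haa'.le⟩
  obtain ⟨β, hβ, hβm⟩ := ((hc T hTc).isClosed.inter isClosed_Ici).isCompact.exists_isLeast
    (s := T ∩ Ici b') ⟨b, hbT, hbb'.le⟩
  have ha'b' : a' < b' := hl.1.trans_lt hlb'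
  have heq : f α = f β := by
    refine (hc T hTc).gap α hα.1 β hβ.1 ((show α ≤ a' from hα.2).trans_lt
      (ha'b'.trans_le hβ.2)) (eq_empty_of_forall_notMem ?_)
    rintro x ⟨hx, hxT⟩
    rcases le_total x a' with h | h
    · exact hx.1.not_ge (hαm ⟨hxT, h⟩)
    · exact hx.2.not_ge (hβm ⟨hxT, (hT' x hxT h).le⟩)
  have h1 : dist (f α) (f a) < ε / 2 :=
    hua ⟨hαm ⟨haT, haa'.le⟩, (show α ≤ a' from hα.2).trans_lt ha'u⟩
  have h2 : dist (f β) (f b) < ε / 2 :=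
    hlb ⟨hlb'.trans_le hβ.2, hβm ⟨hbT, hbb'.le⟩⟩
  rw [heq] at h1
  have h3 := dist_triangle_left (f a) (f b) (f β)
  linarith

theorem exists_minimal_isShortcutSet {f : unitInterval → X} (hf : Continuous f) :
    ∃ S, Minimal (IsShortcutSet f) S := by
  refine zorn_superset {S | IsShortcutSet f S} fun c hc hch => ?_
  rcases c.eq_empty_or_nonempty with rfl | hne
  · refine ⟨univ, ⟨isClosed_univ, mem_univ _, mem_univ _, fun a _ b _ hab h => ?_⟩, by simp⟩
    rw [inter_univ] at h
    exact absurd h (nonempty_Ioo.2 hab).ne_empty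
  · exact ⟨⋂₀ c, IsShortcutSet.sInter hf hne hc hch, fun S hS => sInter_subset_of_mem hS⟩

/-- Deleting `Ioo s t` from `S` creates no new gap except `(s, t)`, whose ends have equal values, so
minimality forbids deleting anything. -/
theorem ioo_inter_eq_empty_of_minimal {Y : Type*} {f : unitInterval → Y} {S : Set unitInterval}
    (hS : Minimal (IsShortcutSet f) S) {s t : unitInterval} (hs : s ∈ S) (ht : t ∈ S)
    (h : f s = f t) : Ioo s t ∩ S = ∅ := by
  have key : IsShortcutSet f (S \ Ioo s t) := by
    refine ⟨hS.prop.isClosed.sdiff isOpen_Ioo, ⟨hS.prop.zero_mem, fun h => ?_⟩,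
      ⟨hS.prop.one_mem, fun h => ?_⟩, fun a ha b hb hab hg => ?_⟩
    · exact h.1.not_ge unitInterval.nonneg'
    · exact h.2.not_ge unitInterval.le_one'
    · by_cases hne : Ioo a b ∩ S = ∅
      · exact hS.prop.gap a ha.1 b hb.1 hab hne
      obtain ⟨u, hu, huS⟩ := nonempty_iff_ne_empty.2 hne
      have hno : ∀ x ∈ S \ Ioo s t, x ∉ Ioo a b := fun x hx hx' =>
        (hg ▸ (⟨hx', hx⟩ : x ∈ Ioo a b ∩ (S \ Ioo s t)) : x ∈ (∅ : Set unitInterval))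
      have hust : u ∈ Ioo s t := by
        by_contra hcon
        exact hno u ⟨huS, hcon⟩ hu
      have hsa : a = s := by
        refine le_antisymm (le_of_not_gt fun hlt => ?_) (le_of_not_gt fun hlt => ?_)
        · exact ha.2 ⟨hlt, hu.1.trans hust.2⟩
        · exact hno s ⟨hs, fun h => h.1.false⟩ ⟨hlt, hust.1.trans hu.2⟩
      have htb : b = t := by
        refine le_antisymm (le_of_not_gt fun hlt => ?_) (le_of_not_gt fun hlt => ?_)
        · exact hno t ⟨ht, fun h => h.2.false⟩ ⟨hu.1.trans hust.2, hlt⟩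
        · exact hb.2 ⟨hust.1.trans hu.2, hlt⟩
      rw [hsa, htb, h]
  have := hS.le_of_le key sdiff_subset
  refine eq_empty_of_forall_notMem fun x hx => (this hx.2).2 hx.1

/-- `h` is constant between any two points where it takes the same value. -/
def HasIntervalFibers (h : unitInterval → X) : Prop :=
  ∀ s t u, s ≤ u → u ≤ t → h s = h t → h u = h s

/-- On each gap of a minimal shortcut set, `f` is replaced by its common value at the ends: `h = f ∘
r`, where `r t` is the last point of the set up to `t`. -/
theorem exists_hasIntervalFibers {f : unitInterval → X} (hf : Continuous f) :
    ∃ h : unitInterval → X, Continuous h ∧ HasIntervalFibers h ∧ h 0 = f 0 ∧ h 1 = f 1 ∧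
      range h ⊆ range f := by
  obtain ⟨S, hS⟩ := exists_minimal_isShortcutSet hf
  have hr : ∀ t, ∃ r, IsGreatest (S ∩ Iic t) r := fun t =>
    (hS.prop.isClosed.inter isClosed_Iic).isCompact.exists_isGreatest
      ⟨0, hS.prop.zero_mem, unitInterval.nonneg'⟩
  have hl : ∀ t, ∃ l, IsLeast (S ∩ Ici t) l := fun t =>
    (hS.prop.isClosed.inter isClosed_Ici).isCompact.exists_isLeast
      ⟨1, hS.prop.one_mem, unitInterval.le_one'⟩
  choose r hr using hr
  choose l hl using hl
  have hrS : ∀ t, r t ∈ S := fun t => (hr t).1.1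
  have hrle : ∀ t, r t ≤ t := fun t => (hr t).1.2
  have hrmax : ∀ t, ∀ s ∈ S, s ≤ t → s ≤ r t := fun t s hs hst => (hr t).2 ⟨hs, hst⟩
  have hlS : ∀ t, l t ∈ S := fun t => (hl t).1.1
  have hlle : ∀ t, t ≤ l t := fun t => (hl t).1.2
  have hlmin : ∀ t, ∀ s ∈ S, t ≤ s → l t ≤ s := fun t s hs hst => (hl t).2 ⟨hs, hst⟩
  have hrfix : ∀ s ∈ S, r s = s := fun s hs => le_antisymm (hrle s) (hrmax s s hs le_rfl)
  have hmono : Monotone r := fun s t hst => hrmax t _ (hrS s) ((hrle s).trans hst)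
  have hrl : ∀ t, f (r t) = f (l t) := fun t => by
    rcases ((hrle t).trans (hlle t)).eq_or_lt with h | h
    · rw [h]
    refine hS.prop.gap _ (hrS t) _ (hlS t) h (eq_empty_of_forall_notMem ?_)
    rintro x ⟨hx, hxS⟩
    rcases le_total x t with h' | h'
    · exact hx.1.not_ge (hrmax t x hxS h')
    · exact hx.2.not_ge (hlmin t x hxS h')
  refine ⟨f ∘ r, ?_, ?_, ?_, ?_, range_comp_subset_range r f⟩
  -- Although `r` may jump, unequal values of `f ∘ r` at `s` and `t` are values of `f` at points of
  -- `[s, t]`, so `f ∘ r` inherits the modulus of continuity of `f`.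
  · have key : ∀ s t, s ≤ t → f (r s) = f (r t) ∨
        ∃ σ ∈ Icc s t, ∃ τ ∈ Icc s t, f (r s) = f σ ∧ f (r t) = f τ := by
      intro s t hst
      rcases le_or_gt (l s) (r t) with h | h
      · exact Or.inr ⟨l s, ⟨hlle s, h.trans (hrle t)⟩, r t, ⟨(hlle s).trans h, hrle t⟩, hrl s, rfl⟩
      · refine Or.inl (congrArg f (le_antisymm (hmono hst) ?_))
        by_contra hcon
        rw [not_le] at hcon
        refine h.not_ge (hlmin s _ (hrS t) ?_)
        by_contra hcon'
        exact hcon.not_ge (hrmax s _ (hrS t) (not_le.1 hcon').le)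
    have hu := Metric.uniformContinuous_iff.1
      (CompactSpace.uniformContinuous_of_continuous hf)
    rw [Metric.continuous_iff]
    intro b ε hε
    obtain ⟨δ, hδ, hδf⟩ := hu ε hε
    have main : ∀ s t, s ≤ t → dist s t < δ → dist (f (r s)) (f (r t)) < ε := by
      intro s t hst hd
      rcases key s t hst with h | ⟨σ, hσ, τ, hτ, h1, h2⟩
      · simpa [h] using hε
      · rw [h1, h2]
        exact hδf ((Real.dist_le_of_mem_Icc (x := (σ : ℝ)) (y := τ) (x' := s) (y' := t)
          hσ hτ).trans_lt (by rwa [dist_comm, Subtype.dist_eq, Real.dist_eq, abs_of_nonneg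
            (sub_nonneg.2 (Subtype.coe_le_coe.2 hst))] at hd))
    refine ⟨δ, hδ, fun a ha => ?_⟩
    rcases le_total a b with h | h
    · exact main a b h ha
    · rw [dist_comm] at ha ⊢
      exact main b a h ha
  · intro s t u hsu hut h
    rcases (hmono (hsu.trans hut)).eq_or_lt with heq | hlt
    · have : r u = r s := le_antisymm ((hmono hut).trans heq.ge) (hmono hsu)
      simp [this]
    · have hg := ioo_inter_eq_empty_of_minimal hS (hrS s) (hrS t) h
      rcases (hmono hsu).eq_or_lt with h1 | h1
      · simp [h1]
      rcases (hmono hut).eq_or_lt with h2 | h2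
      · simpa [h2] using h.symm
      exact ((hg ▸ (⟨⟨h1, h2⟩, hrS u⟩ : r u ∈ Ioo (r s) (r t) ∩ S) :
        r u ∈ (∅ : Set unitInterval))).elim
  · simp [hrfix 0 hS.prop.zero_mem]
  · simp [hrfix 1 hS.prop.one_mem]

/-- The largest distance from `h q` to a point of `h` on the parameters between `q` and `t`. -/
def forwardSpread (h : unitInterval → X) (q t : unitInterval) : ℝ :=
  sSup ((fun u => dist (h q) (h (q ⊔ (u ⊓ t)))) '' univ)

section ForwardSpread

variable {h : unitInterval → X}

theorem continuous_forwardSpread (hc : Continuous h) (q : unitInterval) :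
    Continuous (forwardSpread h q) :=
  isCompact_univ.continuous_sSup (f := fun t u => dist (h q) (h (q ⊔ (u ⊓ t))))
    (by
      change Continuous fun x : unitInterval × unitInterval => dist (h q) (h (q ⊔ (x.2 ⊓ x.1)))
      fun_prop)

theorem le_forwardSpread (hc : Continuous h) (q t u : unitInterval) :
    dist (h q) (h (q ⊔ (u ⊓ t))) ≤ forwardSpread h q t :=
  le_csSup (isCompact_univ.image (by fun_prop)).bddAbove ⟨u, mem_univ _, rfl⟩

theorem forwardSpread_le {q t : unitInterval} {C : ℝ}
    (hC : ∀ u, dist (h q) (h (q ⊔ (u ⊓ t))) ≤ C) : forwardSpread h q t ≤ C := by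
  refine csSup_le (univ_nonempty.image _) ?_
  rintro _ ⟨u, -, rfl⟩
  exact hC u

theorem monotone_forwardSpread (hc : Continuous h) (q : unitInterval) :
    Monotone (forwardSpread h q) := by
  intro s t hst
  refine forwardSpread_le fun u => ?_
  have := le_forwardSpread hc q t (u ⊓ s)
  rwa [inf_assoc, inf_eq_left.2 hst] at this

theorem forwardSpread_eq_of_eq (hc : Continuous h) (hi : HasIntervalFibers h) (q : unitInterval)
    {s t : unitInterval} (hst : s ≤ t) (heq : h s = h t) :
    forwardSpread h q s = forwardSpread h q t := by
  refine le_antisymm (monotone_forwardSpread hc q hst) (forwardSpread_le fun u => ?_)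
  have h0 : 0 ≤ forwardSpread h q s := dist_nonneg.trans (le_forwardSpread hc q s 0)
  rcases le_total (u ⊓ t) q with h1 | h1
  · simpa [sup_eq_left.2 h1] using h0
  rw [sup_eq_right.2 h1]
  rcases le_total (u ⊓ t) s with h2 | h2
  · simpa [inf_eq_left.2 h2, sup_eq_right.2 h1] using le_forwardSpread hc q s (u ⊓ t)
  rw [hi s t _ h2 inf_le_right heq]
  rcases le_total s q with h3 | h3
  · rw [hi s t q h3 (h1.trans inf_le_right) heq, dist_self]
    exact h0
  · simpa [sup_eq_right.2 h3] using le_forwardSpread hc q s s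

theorem forwardSpread_lt (hc : Continuous h) {q s t : unitInterval} (hsq : s ≤ q)
    (hqt : q ≤ t) (hne : h q ≠ h t) :
    forwardSpread h q s < forwardSpread h q t := by
  have h1 : forwardSpread h q s ≤ 0 := forwardSpread_le fun u => by
    simp [sup_eq_left.2 (inf_le_right.trans hsq : u ⊓ s ≤ q)]
  have h2 := le_forwardSpread hc q t t
  rw [inf_idem, sup_eq_right.2 hqt] at h2
  exact h1.trans_lt ((dist_pos.2 hne).trans_le h2)

/-- A weighted sum of forward spreads over a dense sequence of base points. If `h s ≠ h t`, a base
point just after `s` still has a value other than `h t`, and its spread grows strictly from `s` to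
`t`. -/
theorem exists_monotone_of_hasIntervalFibers (hc : Continuous h) (hi : HasIntervalFibers h) :
    ∃ m : unitInterval → ℝ, Continuous m ∧ Monotone m ∧ ∀ s t, m s = m t ↔ h s = h t := by
  obtain ⟨C, hC⟩ := Metric.isBounded_iff.1 (isCompact_range hc).isBounded
  let q := TopologicalSpace.denseSeq unitInterval
  let m : unitInterval → ℝ := fun t => ∑' n, (1 / 2 : ℝ) ^ n * forwardSpread h (q n) t
  have hnn : ∀ n t, 0 ≤ forwardSpread h (q n) t := fun n t =>
    dist_nonneg.trans (le_forwardSpread hc (q n) t 0)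
  have hbd : ∀ n t, ‖(1 / 2 : ℝ) ^ n * forwardSpread h (q n) t‖ ≤ (1 / 2 : ℝ) ^ n * C :=
    fun n t => by
      rw [Real.norm_of_nonneg (mul_nonneg (by positivity) (hnn n t))]
      gcongr
      exact forwardSpread_le fun u => hC (mem_range_self _) (mem_range_self _)
  have hsum : Summable fun n => (1 / 2 : ℝ) ^ n * C := summable_geometric_two.mul_right C
  have hs : ∀ t, Summable fun n => (1 / 2 : ℝ) ^ n * forwardSpread h (q n) t := fun t =>
    Summable.of_norm_bounded hsum fun n => hbd n t
  have hm : Monotone m := fun s t hst => (hs s).tsum_le_tsum (fun n => by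
    have := monotone_forwardSpread hc (q n) hst
    gcongr) (hs t)
  have heq : ∀ s t, s ≤ t → h s = h t → m s = m t := fun s t hst he =>
    tsum_congr fun n => by rw [forwardSpread_eq_of_eq hc hi (q n) hst he]
  have hlt : ∀ s t, s ≤ t → h s ≠ h t → m s < m t := fun s t hst hne => by
    have hst' : s < t := hst.lt_of_ne fun h' => hne (congrArg h h')
    obtain ⟨v, hv, hsv⟩ := (mem_nhdsGE_iff_exists_mem_Ioc_Ico_subset hst').1
      (mem_nhdsWithin_of_mem_nhds (hc.continuousAt (isOpen_ne.mem_nhds hne)))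
    obtain ⟨n, hn⟩ := (TopologicalSpace.denseRange_denseSeq unitInterval).exists_mem_open
      isOpen_Ioo (nonempty_Ioo.2 hv.1)
    refine (hs s).tsum_lt_tsum (i := n) (fun k => ?_) ?_ (hs t)
    · have := monotone_forwardSpread hc (q k) hst
      gcongr
    · have := forwardSpread_lt hc (q := q n) hn.1.le (hn.2.le.trans hv.2) (hsv ⟨hn.1.le, hn.2⟩)
      gcongr
  refine ⟨m, continuous_tsum (fun n => continuous_const.mul (continuous_forwardSpread hc (q n)))
    hsum hbd, hm, fun s t => ⟨fun he => ?_, fun he => ?_⟩⟩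
  · by_contra hne
    rcases le_total s t with h' | h'
    · exact (hlt s t h' hne).ne he
    · exact (hlt t s h' (Ne.symm hne)).ne' he
  · rcases le_total s t with h' | h'
    · exact heq s t h' he
    · exact (heq t s h' he.symm).symm

end ForwardSpread

/-- Every path with distinct endpoints contains an arc with the same endpoints. -/
theorem Path.exists_injective {x y : X} (p : Path x y) (hxy : x ≠ y) :
    ∃ η : Path x y, Function.Injective η ∧ range η ⊆ range p := by
  obtain ⟨h, hc, hi, h0, h1, hr⟩ := exists_hasIntervalFibers p.continuous
  obtain ⟨m, hmc, hm, hmi⟩ := exists_monotone_of_hasIntervalFibers hc hi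
  rw [p.source] at h0
  rw [p.target] at h1
  have hlt : m 0 < m 1 := (hm zero_le_one).lt_of_ne fun h' => hxy (by
    rw [← h0, ← h1]; exact (hmi 0 1).1 h')
  have hsurj : ∀ c : unitInterval, ∃ t, m t = m 0 + c * (m 1 - m 0) := fun c => by
    have hmem : m 0 + c * (m 1 - m 0) ∈ Icc (m 0) (m 1) :=
      ⟨by nlinarith [c.2.1], by nlinarith [c.2.2]⟩
    exact (intermediate_value_Icc (zero_le_one' unitInterval) hmc.continuousOn hmem).imp
      fun t ht => ht.2
  choose τ hτ using hsurj
  let n : unitInterval → unitInterval := fun t => ⟨(m t - m 0) / (m 1 - m 0),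
    div_nonneg (sub_nonneg.2 (hm unitInterval.nonneg')) (sub_pos.2 hlt).le,
    div_le_one_of_le₀ (sub_le_sub_right (hm unitInterval.le_one') _) (sub_pos.2 hlt).le⟩
  have hn : Continuous n := ((hmc.sub continuous_const).div_const _).subtype_mk _
  have hne : m 1 - m 0 ≠ 0 := (sub_pos.2 hlt).ne'
  have hnτ : ∀ c, n (τ c) = c := fun c => Subtype.ext (by simp [n, hτ, hne])
  have hτn : ∀ t, h (τ (n t)) = h t := fun t => (hmi _ _).1 (by
    rw [hτ]; simp only [n]; field_simp; ring)
  -- The section `τ` need not be continuous, but `h = (h ∘ τ) ∘ n` is, and `n` is a quotient map.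
  have hquot : IsQuotientMap n := hn.isClosedMap.isQuotientMap hn fun c => ⟨τ c, hnτ c⟩
  refine ⟨⟨⟨h ∘ τ, ?_⟩, ?_, ?_⟩, ?_, ?_⟩
  · rw [hquot.continuous_iff]
    exact hc.congr fun t => (hτn t).symm
  · have : n 0 = 0 := Subtype.ext (by simp [n])
    have h2 := hτn 0
    rw [this] at h2
    exact h2.trans h0
  · have : n 1 = 1 := Subtype.ext (by simp [n, hne])
    have h2 := hτn 1
    rw [this] at h2
    exact h2.trans h1
  · intro c d hcd
    have h2 : m (τ c) = m (τ d) := (hmi _ _).2 hcd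
    rw [← hnτ c, ← hnτ d]
    simp only [n, h2]
  · exact (range_comp_subset_range τ h).trans hr

end Arc

end

noncomputable section

/-! ### Accessible boundary points -/

/-- A boundary point at which an open set is locally connected is the endpoint of a path in it. -/
theorem exists_joinedIn_insert {X : Type*} [MetricSpace X] {V : Set X} {x : X}
    (hx : x ∈ closure V)
    (h : ∀ ε > 0, ∃ δ > 0, ∀ p ∈ V ∩ Metric.ball x δ, ∀ q ∈ V ∩ Metric.ball x δ,
      JoinedIn (V ∩ Metric.ball x ε) p q) :
    ∃ p ∈ V, JoinedIn (insert x V) x p := by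
  choose! δ hδ hj using h
  let e : ℕ → ℝ := fun n => 1 / ((n : ℝ) + 1)
  have he : ∀ n, 0 < e n := fun n => Nat.one_div_pos_of_nat
  -- The second bound puts `p (n + 1)`, like `p n`, in the ball of radius `δ (e n)`; for `n = 0`
  -- truncated subtraction only repeats the first bound.
  have hp : ∀ n, ∃ p ∈ V, dist p x < δ (e n) ∧ dist p x < δ (e (n - 1)) := fun n => by
    obtain ⟨p, hpV, hd⟩ := Metric.mem_closure_iff.1 hx (min (δ (e n)) (δ (e (n - 1))))
      (lt_min (hδ _ (he _)) (hδ _ (he _)))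
    rw [dist_comm, lt_min_iff] at hd
    exact ⟨p, hpV, hd⟩
  choose p hpV hp1 hp2 using hp
  have hJ : ∀ n, JoinedIn (V ∩ Metric.ball x (e n)) (p n) (p (n + 1)) := fun n =>
    hj _ (he n) _ ⟨hpV n, hp1 n⟩ _ ⟨hpV (n + 1), hp2 (n + 1)⟩
  let P : ∀ n, Path (p n) (p (n + 1)) := fun n => (hJ n).somePath
  have hP : ∀ n t, (P n).extend t ∈ V ∩ Metric.ball x (e n) := fun n t =>
    (hJ n).somePath_mem _
  let c : ℝ → X := fun t => (P ⌊t⌋₊).extend (t - ⌊t⌋₊)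
  have hcf : ∀ (n : ℕ) (t : ℝ), ⌊t⌋₊ = n → c t = (P n).extend (t - n) := by
    rintro _ t rfl
    rfl
  have hcn : ∀ n : ℕ, ∀ t ∈ Icc (n : ℝ) (n + 1), c t = (P n).extend (t - n) := fun n t ht => by
    rcases ht.2.eq_or_lt with rfl | hlt
    · rw [hcf (n + 1) _ (by exact_mod_cast Nat.floor_natCast (n + 1))]
      simp
    · exact hcf n t ((Nat.floor_eq_iff (n.cast_nonneg.trans ht.1)).2 ⟨ht.1, hlt⟩)
  have hcc : ContinuousOn c (Ici 0) := by
    have hU : Ici (0 : ℝ) = ⋃ n : ℕ, Icc (n : ℝ) (n + 1) := by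
      ext t
      simp only [mem_Ici, mem_iUnion, mem_Icc]
      exact ⟨fun ht => ⟨⌊t⌋₊, Nat.floor_le ht, (Nat.lt_floor_add_one t).le⟩,
        fun ⟨n, hn, _⟩ => n.cast_nonneg.trans hn⟩
    rw [hU]
    refine LocallyFinite.continuousOn_iUnion (fun t => ⟨Iio (t + 1), Iio_mem_nhds (by linarith),
      (finite_Iio (⌈t + 1⌉₊)).subset ?_⟩) (fun n => isClosed_Icc) fun n => ?_
    · rintro n ⟨s, hs, hs'⟩
      exact Nat.lt_ceil.2 (hs.1.trans_lt hs')
    · exact ((P n).continuous_extend.comp (continuous_id.sub continuous_const)).continuousOn.congr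
        (hcn n)
  have hcV : ∀ t, c t ∈ V := fun t => (hP _ _).1
  have hcd : ∀ t, dist (c t) x < e ⌊t⌋₊ := fun t => (hP _ _).2
  have hcm : Continuous fun t => c (max t 0) :=
    hcc.comp_continuous (by fun_prop) fun t => le_max_right t 0
  -- The substitution `1 / s - 1` carries `(0, 1]` to `[0, ∞)`, so the infinite concatenation `c` is
  -- run backwards, tending to `x` as `s → 0`.
  let f : ℝ → X := fun s => if s ≤ 0 then x else c (max (1 / s - 1) 0)
  have hfpos : ∀ s, 0 < s → f s = c (max (1 / s - 1) 0) := fun s hs => if_neg hs.not_ge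
  refine ⟨f 1, hfpos 1 one_pos ▸ hcV _, JoinedIn.ofLine (f := f) ?_ (by simp [f]) rfl ?_⟩
  · intro s hs
    rcases hs.1.eq_or_lt with rfl | hpos
    · refine ContinuousAt.continuousWithinAt (Metric.continuousAt_iff.2 fun ε hε => ?_)
      obtain ⟨n, hn⟩ := exists_nat_one_div_lt hε
      refine ⟨1 / ((n : ℝ) + 1), Nat.one_div_pos_of_nat, fun {s} hs => ?_⟩
      have hf0 : f 0 = x := by simp [f]
      rw [hf0]
      by_cases h0 : s ≤ 0
      · simpa [f, h0] using hε
      · simp only [f, h0, if_false]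
        rw [not_le] at h0
        rw [Real.dist_eq, sub_zero, abs_of_pos h0] at hs
        have h1 : (n : ℝ) ≤ 1 / s - 1 := by
          have := (lt_one_div h0 (by positivity)).1 hs
          linarith
        have h2 : n ≤ ⌊max (1 / s - 1) 0⌋₊ := Nat.le_floor (h1.trans (le_max_left _ _))
        refine ((hcd _).trans_le ?_).trans hn
        exact Nat.one_div_le_one_div h2
    · have h1 : ContinuousAt (fun s : ℝ => c (max (1 / s - 1) 0)) s :=
        ContinuousAt.comp (f := fun s : ℝ => 1 / s - 1) hcm.continuousAt
          ((continuousAt_const.div continuousAt_id hpos.ne').sub continuousAt_const)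
      refine (h1.congr ?_).continuousWithinAt
      filter_upwards [Ioi_mem_nhds hpos] with u hu
      exact (hfpos u hu).symm
  · rintro _ ⟨s, -, rfl⟩
    by_cases h0 : s ≤ 0
    · simp [f, h0]
    · simp only [f, h0, if_false]
      exact Or.inr (hcV _)

/-! ### Arcs close to a given arc -/

theorem exists_thickening_hausdorffDist_lt {z₀ z₁ : ℂ} (γ : Path z₀ z₁)
    (hγ : Function.Injective γ) {ε : ℝ} (hε : 0 < ε) :
    ∃ δ > 0, ∀ η : Path z₀ z₁, range η ⊆ Metric.thickening δ (range γ) →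
      Metric.hausdorffDist (range η) (range γ) < ε := by
  let T : Set (unitInterval × unitInterval × unitInterval) :=
    {x | x.1 ≤ x.2.1 ∧ x.2.1 ≤ x.2.2 ∧ ε / 2 ≤ dist (γ x.1) (γ x.2.1)}
  have hT : IsCompact T := by
    refine IsClosed.isCompact ?_
    exact (isClosed_le (by fun_prop) (by fun_prop)).inter
      ((isClosed_le (by fun_prop) (by fun_prop)).inter (isClosed_le continuous_const
        (Continuous.dist (by fun_prop) (by fun_prop))))
  -- By injectivity and compactness, an excursion of `γ` that reaches distance `ε / 2` from its
  -- start cannot come back within `d` of it.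
  obtain ⟨d, hd, hdT⟩ := hT.exists_forall_le' (f := fun x => dist (γ x.1) (γ x.2.2)) (a := 0)
    (by fun_prop) (by
      rintro ⟨s, t, u⟩ ⟨h1, h2, h3⟩
      refine dist_pos.2 fun h => ?_
      have hsu : s = u := hγ h
      have hst : s = t := le_antisymm h1 (h2.trans hsu.ge)
      simp only [hst, dist_self] at h3
      linarith)
  refine ⟨min (ε / 4) (d / 2), by positivity, fun η hη => ?_⟩
  set δ := min (ε / 4) (d / 2)
  have hδ1 : δ ≤ ε / 4 := min_le_left _ _
  have hδ2 : δ ≤ d / 2 := min_le_right _ _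
  have hδ : 0 < δ := by positivity
  have hcov : ∀ s, ∃ u, dist (η s) (γ u) < δ := fun s => by
    obtain ⟨_, ⟨u, rfl⟩, hu⟩ := Metric.mem_thickening_iff.1 (hη (mem_range_self s))
    exact ⟨u, hu⟩
  refine (Metric.hausdorffDist_le_of_mem_dist (r := 3 * ε / 4) (by positivity) ?_ ?_).trans_lt
    (by linarith)
  · rintro _ ⟨s, rfl⟩
    obtain ⟨u, hu⟩ := hcov s
    exact ⟨γ u, mem_range_self u, by linarith⟩
  · rintro _ ⟨t, rfl⟩
    by_contra! hcon
    have hfar : ∀ s, 3 * ε / 4 < dist (γ t) (η s) := fun s => hcon _ (mem_range_self s)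
    -- If `η` stays far from `γ t`, it is covered by balls centred before and after time `t`. Being
    -- connected, it has a point in both, near some `γ u` and `γ v` with `u < t < v`; then `dist (γ
    -- u) (γ v) < d` forces that point to be near `γ t`.
    let A : Set ℂ := ⋃ u ∈ Iio t, Metric.ball (γ u) δ
    let B : Set ℂ := ⋃ u ∈ Ioi t, Metric.ball (γ u) δ
    have hA : IsOpen A := isOpen_biUnion fun _ _ => Metric.isOpen_ball
    have hB : IsOpen B := isOpen_biUnion fun _ _ => Metric.isOpen_ball
    have hne : ∀ u s, dist (η s) (γ u) < δ → u ≠ t := by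
      rintro u s hu rfl
      have := hfar s
      rw [dist_comm] at this
      linarith
    have h0 : η 0 ∈ A := by
      have h1 : dist (η 0) (γ 0) < δ := by simpa using hδ
      exact mem_biUnion (x := (0 : unitInterval))
        (lt_of_le_of_ne unitInterval.nonneg' (hne 0 0 h1)) h1
    have h1 : η 1 ∈ B := by
      have h1 : dist (η 1) (γ 1) < δ := by simpa using hδ
      exact mem_biUnion (x := (1 : unitInterval))
        (lt_of_le_of_ne unitInterval.le_one' (hne 1 1 h1).symm) h1
    obtain ⟨z, ⟨s, hs⟩, hzA, hzB⟩ := (isPreconnected_range η.continuous) A B hA hB (by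
      rintro _ ⟨s, rfl⟩
      obtain ⟨u, hu⟩ := hcov s
      rcases lt_or_gt_of_ne (hne u s hu) with h | h
      · exact Or.inl (mem_biUnion (x := u) h hu)
      · exact Or.inr (mem_biUnion (x := u) h hu)) ⟨_, mem_range_self 0, h0⟩ ⟨_, mem_range_self 1, h1⟩
    simp only [A, B, mem_iUnion, Metric.mem_ball, mem_Iio, mem_Ioi] at hzA hzB
    obtain ⟨u, hut, hu⟩ := hzA
    obtain ⟨v, htv, hv⟩ := hzB
    have hdist : dist (γ u) (γ v) < d := by
      have := dist_triangle_left (γ u) (γ v) z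
      linarith
    have hlt : dist (γ u) (γ t) < ε / 2 := by
      by_contra hge
      exact hdist.not_ge (hdT ⟨u, t, v⟩ ⟨hut.le, htv.le, not_lt.1 hge⟩)
    have h2 := hfar s
    rw [hs] at h2
    have h3 := dist_triangle_right (γ t) z (γ u)
    rw [dist_comm] at hlt
    linarith

/-- The loop runs along `η` on `[0, 1/2]` and back along `γ` on `[1/2, 1]`; it is injective on `[0,
1)` and descends to the circle. -/
theorem isJordanCurve_union {z₀ z₁ : ℂ} {γ η : Path z₀ z₁} (hγ : Function.Injective γ)
    (hη : Function.Injective η) (h : range η ∩ range γ ⊆ {z₀, z₁}) :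
    IsJordanCurve (range η ∪ range γ) := by
  let F : ℝ → ℂ := fun t => if t ≤ 1 / 2 then η.extend (2 * t) else γ.extend (2 - 2 * t)
  have hF : Continuous F := by
    refine Continuous.if_le (by fun_prop) (by fun_prop) continuous_id continuous_const ?_
    rintro t rfl
    norm_num
  have h01 : F 0 = F (0 + 1) := by norm_num [F]
  have hηe : ∀ t (ht : t ∈ unitInterval), η.extend t = η ⟨t, ht⟩ := fun t ht =>
    Path.extend_apply _ ht
  have hγe : ∀ t (ht : t ∈ unitInterval), γ.extend t = γ ⟨t, ht⟩ := fun t ht =>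
    Path.extend_apply _ ht
  have hmix : ∀ s t : ℝ, s ∈ Icc (0 : ℝ) (1 / 2) → t ∈ Ioo (1 / 2 : ℝ) 1 →
      η.extend (2 * s) ≠ γ.extend (2 - 2 * t) := by
    intro s t hs ht heq
    have hs' : 2 * s ∈ unitInterval := ⟨by linarith [hs.1], by linarith [hs.2]⟩
    have ht' : 2 - 2 * t ∈ unitInterval := ⟨by linarith [ht.2], by linarith [ht.1]⟩
    rw [hηe _ hs', hγe _ ht'] at heq
    rcases h ⟨mem_range_self ⟨_, hs'⟩, heq ▸ mem_range_self _⟩ with h1 | h1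
    · rw [heq] at h1
      have := congrArg Subtype.val (hγ (h1.trans γ.source.symm))
      simp only [Icc.coe_zero] at this
      linarith [ht.2]
    · rw [mem_singleton_iff, heq] at h1
      have := congrArg Subtype.val (hγ (h1.trans γ.target.symm))
      simp only [Icc.coe_one] at this
      linarith [ht.1]
  have hinj : InjOn F (Ico 0 1) := by
    intro s hs t ht heq
    by_cases h1 : s ≤ 1 / 2 <;> by_cases h2 : t ≤ 1 / 2
    · simp only [F, h1, h2, if_true] at heq
      rw [hηe _ ⟨by linarith [hs.1], by linarith⟩, hηe _ ⟨by linarith [ht.1], by linarith⟩] at heq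
      have := congrArg Subtype.val (hη heq)
      simp only at this
      linarith
    · simp only [F, h1, h2, if_true, if_false] at heq
      exact absurd heq (hmix s t ⟨hs.1, h1⟩ ⟨not_le.1 h2, ht.2⟩)
    · simp only [F, h1, h2, if_true, if_false] at heq
      exact absurd heq.symm (hmix t s ⟨ht.1, h2⟩ ⟨not_le.1 h1, hs.2⟩)
    · simp only [F, h1, h2, if_false] at heq
      rw [not_le] at h1 h2
      rw [hγe _ ⟨by linarith [hs.2], by linarith⟩, hγe _ ⟨by linarith [ht.2], by linarith⟩] at heq
      have := congrArg Subtype.val (hγ heq)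
      simp only at this
      linarith
  have himg : F '' Ico 0 1 = range η ∪ range γ := by
    ext z
    constructor
    · rintro ⟨t, -, rfl⟩
      by_cases h1 : t ≤ 1 / 2
      · simp only [F, h1, if_true]
        exact Or.inl (η.extend_range ▸ mem_range_self _)
      · simp only [F, h1, if_false]
        exact Or.inr (γ.extend_range ▸ mem_range_self _)
    · rintro (⟨t, rfl⟩ | ⟨t, rfl⟩)
      · have ht : (t : ℝ) / 2 ≤ 1 / 2 := by linarith [t.2.2]
        refine ⟨t / 2, ⟨by linarith [t.2.1], by linarith [t.2.2]⟩, ?_⟩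
        simp only [F, ht, if_true]
        rw [mul_div_cancel₀ _ two_ne_zero, hηe _ t.2]
      · rcases eq_or_ne t 0 with rfl | ht0
        · exact ⟨0, by simp, by simp [F]⟩
        rcases eq_or_ne t 1 with rfl | ht1
        · exact ⟨1 / 2, by norm_num, by simp [F]⟩
        have h0 : (0 : ℝ) < t := lt_of_le_of_ne t.2.1 fun h' => ht0 (Subtype.ext h'.symm)
        have h1 : (t : ℝ) < 1 := lt_of_le_of_ne t.2.2 fun h' => ht1 (Subtype.ext h')
        refine ⟨1 - t / 2, ⟨by linarith, by linarith⟩, ?_⟩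
        have : ¬ (1 - (t : ℝ) / 2 ≤ 1 / 2) := by linarith
        simp only [F, this, if_false]
        rw [← hγe _ t.2]
        congr 1
        ring
  have : Fact ((0 : ℝ) < 1) := ⟨one_pos⟩
  let G : AddCircle (1 : ℝ) → ℂ := AddCircle.liftIco 1 0 F
  have hG : Continuous G := AddCircle.liftIco_continuous h01 hF.continuousOn
  have hGF : ∀ t ∈ Ico (0 : ℝ) 1, G t = F t := fun t ht =>
    AddCircle.liftIco_coe_apply (by simpa using ht)
  have hsurj : ∀ x : AddCircle (1 : ℝ), ∃ t ∈ Ico (0 : ℝ) 1, (t : AddCircle (1 : ℝ)) = x := fun x => by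
    obtain ⟨t, ht, hx⟩ := (AddCircle.coe_image_Ico_eq (1 : ℝ) 0).symm ▸ mem_univ x
    exact ⟨t, by simpa using ht, hx⟩
  let e : AddCircle (1 : ℝ) ≃ₜ Circle := AddCircle.homeomorphCircle one_ne_zero
  refine ⟨G ∘ e.symm, hG.comp e.symm.continuous, Function.Injective.comp ?_ e.symm.injective, ?_⟩
  · intro x y hxy
    obtain ⟨s, hs, rfl⟩ := hsurj x
    obtain ⟨t, ht, rfl⟩ := hsurj y
    rw [hGF s hs, hGF t ht] at hxy
    rw [hinj hs ht hxy]
  · rw [e.symm.surjective.range_comp, ← himg]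
    ext z
    constructor
    · rintro ⟨x, rfl⟩
      obtain ⟨s, hs, rfl⟩ := hsurj x
      exact ⟨s, hs, (hGF s hs).symm⟩
    · rintro ⟨s, hs, rfl⟩
      exact ⟨s, hGF s hs⟩

/-! ### The perturbation lemma -/

theorem exists_joinedIn_insert_endpoint {z₀ z₁ : ℂ} (γ : Path z₀ z₁) (hγ : Function.Injective γ)
    {K : Set ℂ} (hK : IsCompact K) (hd : IsTotallyDisconnected K) {W : Set ℂ} (hW : IsOpen W)
    (h0 : z₀ ∈ W) :
    ∃ p ∈ (W \ range γ) \ K, JoinedIn (insert z₀ ((W \ range γ) \ K)) z₀ p := by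
  apply exists_joinedIn_insert
  · rw [mem_closure_iff]
    intro O hO hz
    obtain ⟨y, hy⟩ := diff_range_diff_nonempty γ.continuous hγ hK hd (hO.inter hW) ⟨z₀, hz, h0⟩
    exact ⟨y, hy.1.1.1, ⟨hy.1.1.2, hy.1.2⟩, hy.2⟩
  · intro ε hε
    obtain ⟨r, hr, hrW⟩ := Metric.isOpen_iff.1 hW z₀ h0
    obtain ⟨δ, hδ, hj⟩ := exists_ball_joinedIn γ.continuous hγ hK hd (lt_min hε hr)
    rw [γ.source] at hj
    refine ⟨δ, hδ, fun p hp q hq => (hj p ⟨⟨hp.2, hp.1.1.2⟩, hp.1.2⟩ q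
      ⟨⟨hq.2, hq.1.1.2⟩, hq.1.2⟩).mono ?_⟩
    rintro z ⟨⟨hz, hzr⟩, hzK⟩
    exact ⟨⟨⟨hrW (Metric.ball_subset_ball (min_le_right _ _) hz), hzr⟩, hzK⟩,
      Metric.ball_subset_ball (min_le_left _ _) hz⟩

/-- An arc can be perturbed to an arc which, together with it, forms a Jordan curve, and whose
interior avoids a given compact totally disconnected set. -/
theorem exists_isJordanHomotopic {K : Set ℂ} (hK : IsCompact K) (hd : IsTotallyDisconnected K)
    {z₀ z₁ : ℂ} (γ : Path z₀ z₁) (hγ : Function.Injective γ) {ε : ℝ} (hε : 0 < ε) :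
    ∃ η : Path z₀ z₁, IsJordanHomotopic ε γ η ∧
      ∀ t : unitInterval, t ≠ 0 → t ≠ 1 → η t ∉ K := by
  obtain ⟨δ, hδ, hclose⟩ := exists_thickening_hausdorffDist_lt γ hγ hε
  set W := Metric.thickening δ (range γ)
  have hWo : IsOpen W := Metric.isOpen_thickening
  have hWb : Bornology.IsBounded W := (isCompact_range γ.continuous).isBounded.thickening
  have hrW : range γ ⊆ W := Metric.self_subset_thickening hδ _
  have hz₀ : z₀ ∈ range γ := ⟨0, γ.source⟩
  have hz₁ : z₁ ∈ range γ := ⟨1, γ.target⟩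
  have hne : z₀ ≠ z₁ := fun h => zero_ne_one (hγ (by rw [γ.source, γ.target, h]) :
    (0 : unitInterval) = 1)
  set V := (W \ range γ) \ K
  have hro : IsOpen (W \ range γ) := hWo.sdiff (isCompact_range γ.continuous).isClosed
  have hV : IsPreconnected V :=
    (isPreconnected_diff_range γ.continuous hγ ((isPreconnected_range γ.continuous).thickening δ)
      hWo hWb hrW).diff_of_isTotallyDisconnected hro (hWb.subset sdiff_subset) hK hd
  obtain ⟨p, hp, hjp⟩ := exists_joinedIn_insert_endpoint γ hγ hK hd hWo (hrW hz₀)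
  obtain ⟨q, hq, hjq⟩ := exists_joinedIn_insert_endpoint γ.symm
    (hγ.comp unitInterval.symm_bijective.injective) hK hd hWo (hrW hz₁)
  rw [Path.symm_range] at hq hjq
  have hpq : JoinedIn V p q :=
    (((hro.sdiff hK.isClosed).isConnected_iff_isPathConnected).1 ⟨⟨p, hp⟩, hV⟩).joinedIn p hp q hq
  have hj : JoinedIn (insert z₀ (insert z₁ V)) z₀ z₁ :=
    ((hjp.mono (insert_subset_insert (subset_insert _ _))).trans (hpq.mono
      ((subset_insert _ _).trans (subset_insert _ _)))).trans (hjq.mono (subset_insert _ _)).symm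
  -- The joining path may cross itself or revisit the endpoints; the arc inside it, being injective,
  -- takes the values `z₀` and `z₁` only at its ends.
  obtain ⟨η, hη, hηr⟩ := hj.somePath.exists_injective hne
  have hmem : ∀ t, η t ∈ insert z₀ (insert z₁ V) := fun t => by
    obtain ⟨s, hs⟩ := hηr (mem_range_self t)
    rw [← hs]
    exact hj.somePath_mem s
  refine ⟨η, ⟨hη, hclose η ?_, isJordanCurve_union hγ hη ?_⟩, fun t h0 h1 => ?_⟩
  · rintro _ ⟨t, rfl⟩
    rcases hmem t with h | h | h
    · exact hrW (mem_of_eq_of_mem h hz₀)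
    · exact hrW (mem_of_eq_of_mem h hz₁)
    · exact h.1.1
  · rintro _ ⟨⟨t, rfl⟩, ht⟩
    rcases hmem t with h | h | h
    · exact Or.inl h
    · exact Or.inr h
    · exact absurd ht h.1.2
  · rcases hmem t with h | h | h
    · exact absurd (hη (h.trans η.source.symm)) h0
    · exact absurd (hη (h.trans η.target.symm)) h1
    · exact h.2

end

noncomputable section

/-! ### Rational functions with simple poles -/

/-- `Q` is invertible as a power series, so `X * f` is the power series `N * Q⁻¹`, and its constant
term is the required coefficient. -/
theorem coeff_neg_one_of_X_mul_mul_eq {F : Type*} [Field F] {f : RatFunc F} {N Q : Polynomial F}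
    (h : RatFunc.X * f * algebraMap _ (RatFunc F) Q = algebraMap _ (RatFunc F) N)
    (h0 : Q.coeff 0 ≠ 0) : (f : LaurentSeries F).coeff (-1) = N.coeff 0 / Q.coeff 0 := by
  have hmul : (HahnSeries.single 1 1 * (f : LaurentSeries F)) *
      ((Q : PowerSeries F) : LaurentSeries F) = ((N : PowerSeries F) : LaurentSeries F) := by
    have := congrArg (fun x : RatFunc F => (x : LaurentSeries F)) h
    simp only [map_mul] at this
    rw [RatFunc.coe_coe, RatFunc.coe_coe, ← RatFunc.coe_X]
    exact this
  have hinv : (Q : PowerSeries F) * (Q : PowerSeries F)⁻¹ = 1 :=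
    PowerSeries.mul_inv_cancel _ (by simpa using h0)
  have hfin : HahnSeries.single 1 1 * (f : LaurentSeries F)
      = (((N : PowerSeries F) * (Q : PowerSeries F)⁻¹ : PowerSeries F) : LaurentSeries F) := by
    rw [PowerSeries.coe_mul, ← hmul, mul_assoc, ← PowerSeries.coe_mul, hinv, PowerSeries.coe_one,
      mul_one]
  have hcoef := congrArg (fun x => x.coeff (0 : ℤ)) hfin
  simp only [HahnSeries.coeff_single_mul, one_mul, zero_sub] at hcoef
  have h2 := LaurentSeries.coeff_coe_powerSeries ((N : PowerSeries F) * (Q : PowerSeries F)⁻¹) 0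
  rw [Nat.cast_zero] at h2
  rw [hcoef, h2, PowerSeries.coeff_zero_eq_constantCoeff, map_mul, PowerSeries.constantCoeff_inv,
    div_eq_mul_inv]
  simp

theorem ratResidue_eq {R : RatFunc ℂ} {ρ : ℂ} {q : Polynomial ℂ}
    (hq : R.denom = (Polynomial.X - Polynomial.C ρ) * q) (h0 : q.eval ρ ≠ 0) :
    ratResidue R ρ = R.num.eval ρ / q.eval ρ := by
  let N := Polynomial.taylor ρ R.num
  let Q := Polynomial.taylor ρ q
  have hQ0 : Q.coeff 0 = q.eval ρ := Polynomial.taylor_coeff_zero ..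
  have hN0 : N.coeff 0 = R.num.eval ρ := Polynomial.taylor_coeff_zero ..
  have hQ : Q ≠ 0 := fun h => h0 (by rw [← hQ0, h, Polynomial.coeff_zero])
  have hD : Polynomial.taylor ρ R.denom = Polynomial.X * Q := by
    rw [hq, Polynomial.taylor_mul]
    simp [Q]
  have hL : RatFunc.laurent ρ R
      = algebraMap _ (RatFunc ℂ) N / algebraMap _ (RatFunc ℂ) (Polynomial.X * Q) := by
    conv_lhs => rw [← RatFunc.num_div_denom R]
    rw [RatFunc.laurent_div, hD]
  have hQr : algebraMap _ (RatFunc ℂ) Q ≠ 0 := RatFunc.algebraMap_ne_zero hQ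
  have hmul : RatFunc.X * RatFunc.laurent ρ R * algebraMap _ (RatFunc ℂ) Q
      = algebraMap _ (RatFunc ℂ) N := by
    rw [hL, map_mul, RatFunc.algebraMap_X]
    have := RatFunc.X_ne_zero (K := ℂ)
    field_simp
  rw [ratResidue, coeff_neg_one_of_X_mul_mul_eq hmul (by rwa [hQ0]), hN0, hQ0]

theorem denom_eq_nodal {R : RatFunc ℂ} (h : Squarefree R.denom) :
    R.denom = Lagrange.nodal (ratPoles R) id := by
  classical
  have hs : R.denom.Splits := IsAlgClosed.splits _
  have hn : R.denom.roots.Nodup :=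
    (Polynomial.nodup_roots_iff_of_splits (RatFunc.denom_ne_zero R) hs).2
      ((PerfectField.separable_iff_squarefree).2 h)
  conv_lhs => rw [hs.eq_prod_roots_of_monic (RatFunc.monic_denom R)]
  rw [Lagrange.nodal, Finset.prod, ratPoles, Multiset.toFinset_val, hn.dedup]
  rfl

/-- Partial fractions through Lagrange interpolation: the numerator has degree below the number of
poles, so it equals its interpolant at them, and the nodal weights turn its values into residues. -/
theorem ratFun_eq_sum {R : RatFunc ℂ} (h : Squarefree R.denom)
    (hdeg : R.num.degree < R.denom.degree) {z : ℂ} (hz : z ∉ ratPoles R) :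
    ratFun R z = ∑ ρ ∈ ratPoles R, (z - ρ)⁻¹ * ratResidue R ρ := by
  classical
  have hd := denom_eq_nodal h
  have hz' : ∀ i ∈ ratPoles R, z ≠ id i := fun i hi hzi => hz (hzi ▸ hi)
  have hD : R.denom.eval z ≠ 0 := by
    rw [hd]
    exact Lagrange.eval_nodal_not_at_node hz'
  have hN : R.num = Lagrange.interpolate (ratPoles R) id fun i => R.num.eval i := by
    refine Lagrange.eq_interpolate Function.injective_id.injOn ?_
    rwa [hd, Lagrange.degree_nodal] at hdeg
  rw [ratFun, RatFunc.eval, Polynomial.eval₂_id, Polynomial.eval₂_id, div_eq_iff hD]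
  conv_lhs => rw [hN]
  rw [Lagrange.eval_interpolate_not_at_node _ hz', ← hd, mul_comm]
  congr 1
  refine Finset.sum_congr rfl fun ρ hρ => ?_
  have hfac : R.denom = (Polynomial.X - Polynomial.C ρ) *
      Lagrange.nodal ((ratPoles R).erase ρ) id := by
    rw [hd]
    exact Lagrange.nodal_eq_mul_nodal_erase hρ
  rw [ratResidue_eq hfac ?_, Lagrange.nodalWeight_eq_eval_nodal_erase_inv]
  · simp only [id]
    ring
  · exact Lagrange.eval_nodal_not_at_node fun i hi => (Finset.ne_of_mem_erase hi).symm

theorem smul_polarMeasure (R : RatFunc ℂ) (c : ℂ) :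
    c • polarMeasure R = ∑ ρ ∈ ratPoles R, VectorMeasure.dirac ρ (c * ratResidue R ρ) := by
  rw [polarMeasure, Finset.smul_sum]
  refine Finset.sum_congr rfl fun ρ _ => ?_
  ext s hs
  by_cases h : ρ ∈ s <;> simp [hs, h]

theorem cauchyTransform_polarMeasure (R : RatFunc ℂ) (z : ℂ) :
    cauchyTransform ((2 * Real.pi * Complex.I : ℂ) • polarMeasure R) z
      = ∑ ρ ∈ ratPoles R, (z - ρ)⁻¹ * ratResidue R ρ := by
  rw [cauchyTransform, cintegral, smul_polarMeasure,
    VectorMeasure.integral_finsetSum_vectorMeasure fun ρ _ => ?_]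
  · simp only [VectorMeasure.integral_dirac, ContinuousLinearMap.mul_apply', Finset.mul_sum]
    refine Finset.sum_congr rfl fun ρ _ => ?_
    have := Complex.two_pi_I_ne_zero
    field_simp
  · rw [VectorMeasure.Integrable, VectorMeasure.variation_dirac]
    exact (integrable_dirac (by simp)).smul_measure enorm_ne_top

theorem csupport_smul (ν : ComplexMeasure ℂ) {c : ℂ} (hc : c ≠ 0) :
    csupport (c • ν) = csupport ν := by
  rw [csupport, csupport, VectorMeasure.variation_smul]
  ext x
  simp [Measure.mem_support_iff_forall, hc, pos_iff_ne_zero]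

/-! ### Limits of Cauchy transforms off the limit support -/

/-- Makes the Cauchy kernel accessible to weak convergence: multiplied by a bump function vanishing
near `z`, it becomes a test function and is unchanged near `K`. -/
theorem exists_cutoff_inv_sub {K : Set ℂ} (hK : IsCompact K) {z : ℂ} (hz : z ∉ K) :
    ∃ (φ : ℂ → ℂ) (r : ℝ), 0 < r ∧ Continuous φ ∧ HasCompactSupport φ ∧
      ∀ t ∈ Metric.thickening r K, φ t = (z - t)⁻¹ := by
  obtain ⟨r, hr, hrz⟩ := hK.exists_cthickening_subset_open (isOpen_compl_singleton (x := z))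
    (fun t ht h => hz (h ▸ ht))
  obtain ⟨χ, h1, hc, hs, -⟩ := exists_continuousMap_one_of_isCompact_subset_isOpen
    (hK.cthickening (r := r)) isOpen_compl_singleton hrz
  have hts : tsupport (fun t => (χ t : ℂ) * (z - t)⁻¹) ⊆ tsupport χ :=
    closure_mono fun t ht h => ht (by simp [h])
  refine ⟨fun t => χ t * (z - t)⁻¹, r, hr, ?_, hc.of_isClosed_subset (isClosed_tsupport _) hts, ?_⟩
  · refine continuous_of_tsupport fun t ht => ContinuousAt.mul (by fun_prop) ?_
    exact ContinuousAt.inv₀ (by fun_prop) (sub_ne_zero.2 (Ne.symm (hs (hts ht))))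
  · intro t ht
    simp [h1 (Metric.thickening_subset_cthickening r K ht)]

theorem cintegral_congr {ν : ComplexMeasure ℂ} {φ ψ : ℂ → ℂ} (h : EqOn φ ψ (csupport ν)) :
    cintegral ν φ = cintegral ν ψ :=
  VectorMeasure.integral_congr_ae (mem_of_superset Measure.support_mem_ae h)

theorem tendsto_cauchyTransform {ν : ℕ → ComplexMeasure ℂ} {μ : ComplexMeasure ℂ}
    (hw : TendstoWeakly ν μ) (hs : TendstoHausdorff (fun n => csupport (ν n)) (csupport μ))
    (hμ : IsCompact (csupport μ)) {z : ℂ} (hz : z ∉ csupport μ) :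
    Tendsto (fun n => cauchyTransform (ν n) z) atTop (𝓝 (cauchyTransform μ z)) := by
  obtain ⟨φ, r, hr, hφ, hφc, hφe⟩ := exists_cutoff_inv_sub hμ hz
  have hμφ : cintegral μ (fun t => (z - t)⁻¹) = cintegral μ φ :=
    cintegral_congr fun t ht => (hφe t (Metric.self_subset_thickening hr _ ht)).symm
  -- Hausdorff convergence eventually places the supports in the `r`-neighbourhood where `φ` is the
  -- kernel.
  have hev : ∀ᶠ n in atTop, cintegral (ν n) φ = cintegral (ν n) fun t => (z - t)⁻¹ := by
    have h1 : ∀ᶠ n in atTop, Metric.hausdorffEDist (csupport (ν n)) (csupport μ)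
        < ENNReal.ofReal r := hs.eventually_lt_const (ENNReal.ofReal_pos.2 hr)
    filter_upwards [h1] with n hn
    refine cintegral_congr fun t ht => hφe t ?_
    obtain ⟨y, hy, hty⟩ := Metric.exists_edist_lt_of_hausdorffEDist_lt ht hn
    refine Metric.mem_thickening_iff.2 ⟨y, hy, ?_⟩
    rwa [edist_dist, ENNReal.ofReal_lt_ofReal_iff hr] at hty
  simp only [cauchyTransform]
  rw [hμφ]
  exact ((hw φ hφ hφc).congr' hev).const_mul _

theorem IsCauchyApproximation.tendsto {z₀ z₁ : ℂ} {γ : Path z₀ z₁} {μ : ComplexMeasure ℂ}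
    {f : ℕ → ℂ → ℂ} (h : IsCauchyApproximation γ μ f) (hμ : IsCompact (csupport μ)) {z : ℂ}
    (hz : z ∉ csupport μ) : Tendsto (fun n => f n z) atTop (𝓝 (cauchyTransform μ z)) := by
  obtain ⟨ν, -, -, hw, hs, hf⟩ := h
  simpa only [hf] using tendsto_cauchyTransform hw hs hμ hz

theorem IsRationalApproximation.tendsto {z₀ z₁ : ℂ} {γ : Path z₀ z₁} {μ : ComplexMeasure ℂ}
    {f : ℕ → ℂ → ℂ} (h : IsRationalApproximation γ μ f) (hμ : IsCompact (csupport μ)) {z : ℂ}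
    (hzγ : z ∈ range γ) (hz : z ∉ csupport μ) :
    Tendsto (fun n => f n z) atTop (𝓝 (cauchyTransform μ z)) := by
  obtain ⟨R, hR, hdeg, hw, hs, hf⟩ := h
  have hs' : TendstoHausdorff
      (fun n => csupport ((2 * Real.pi * Complex.I : ℂ) • polarMeasure (R n))) (csupport μ) := by
    simpa only [csupport_smul _ Complex.two_pi_I_ne_zero] using hs
  refine (tendsto_cauchyTransform hw hs' hμ hz).congr fun n => ?_
  rw [hf, cauchyTransform_polarMeasure,
    ratFun_eq_sum (hR.simple n) (hdeg n) fun hρ => hR.off n z hρ hzγ]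

/-! ### Uniqueness of Riemann-Stieltjes integrals -/

theorem HasPathIntegral.congr {z₀ z₁ : ℂ} {γ : Path z₀ z₁} {f g : ℂ → ℂ} {I : ℂ}
    (h : HasPathIntegral γ f I) (hfg : EqOn f g (range γ)) : HasPathIntegral γ g I := by
  intro ε hε
  obtain ⟨δ, hδ, hd⟩ := h ε hε
  refine ⟨δ, hδ, fun N t s ht h0 h1 hs => ?_⟩
  simpa only [hfg (mem_range_self _)] using hd N t s ht h0 h1 hs

theorem HasPathIntegral.unique {z₀ z₁ : ℂ} {γ : Path z₀ z₁} {f : ℂ → ℂ} {I J : ℂ}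
    (hI : HasPathIntegral γ f I) (hJ : HasPathIntegral γ f J) : I = J := by
  refine eq_of_forall_dist_le fun ε hε => ?_
  obtain ⟨δ, hδ, hd⟩ := hI (ε / 2) (half_pos hε)
  obtain ⟨δ', hδ', hd'⟩ := hJ (ε / 2) (half_pos hε)
  obtain ⟨N, hN⟩ := exists_nat_one_div_lt (lt_min hδ hδ')
  have hN0 : (0 : ℝ) < (N : ℝ) + 1 := by positivity
  -- One uniform subdivision finer than both meshes gives a single sum close to both integrals; the
  -- projection only clamps the indices beyond `N + 1`.
  let t : ℕ → unitInterval := fun k => projIcc 0 1 zero_le_one ((k : ℝ) / (N + 1))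
  have htm : Monotone t := fun a b hab => monotone_projIcc _ (by gcongr)
  have htk : ∀ k ≤ N + 1, (t k : ℝ) = k / (N + 1) := fun k hk => by
    simp only [t]
    rw [projIcc_of_mem zero_le_one ⟨by positivity, (div_le_one hN0).2 (by exact_mod_cast hk)⟩]
  have h0 : t 0 = 0 := Subtype.ext (by rw [htk 0 (by omega)]; simp)
  have h1 : t (N + 1) = 1 := Subtype.ext (by
    rw [htk (N + 1) le_rfl]
    push_cast
    exact div_self hN0.ne')
  have hmesh : ∀ k < N + 1, (t (k + 1) : ℝ) - t k < min δ δ' := fun k hk => by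
    rw [htk k hk.le, htk (k + 1) hk]
    push_cast
    rw [← sub_div, add_sub_cancel_left]
    exact hN
  have e1 := hd (N + 1) t t htm h0 h1 fun k hk =>
    ⟨le_rfl, htm k.le_succ, (hmesh k hk).trans_le (min_le_left _ _)⟩
  have e2 := hd' (N + 1) t t htm h0 h1 fun k hk =>
    ⟨le_rfl, htm k.le_succ, (hmesh k hk).trans_le (min_le_right _ _)⟩
  rw [← dist_eq_norm] at e1 e2
  have := dist_triangle_left I J
    (∑ k ∈ Finset.range (N + 1), f (γ (t k)) * (γ (t (k + 1)) - γ (t k)))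
  linarith

/-- An interval of parameters mapped into `K` would have a connected image, hence a single point,
against injectivity. -/
theorem dense_preimage_compl {K : Set ℂ} (hd : IsTotallyDisconnected K) {z₀ z₁ : ℂ}
    (γ : Path z₀ z₁) (hγ : Function.Injective γ) : Dense {t | γ t ∉ K} := by
  rw [dense_iff_inter_open]
  intro O hO hne
  obtain ⟨a, b, hab, hsub⟩ := hO.exists_Ioo_subset hne
  by_contra hemp
  have hK : γ '' Ioo a b ⊆ K := by
    rintro _ ⟨t, ht, rfl⟩
    by_contra h
    exact hemp ⟨t, hsub ht, h⟩
  have hsing := hd _ hK (isPreconnected_Ioo.image _ γ.continuous.continuousOn)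
  obtain ⟨c, hac, hcb⟩ := exists_between hab
  obtain ⟨d, hcd, hdb⟩ := exists_between hcb
  exact hcd.ne (hγ (hsing ⟨c, ⟨hac, hcb⟩, rfl⟩ ⟨d, ⟨hac.trans hcd, hdb⟩, rfl⟩))

/-- The Borel extension does not depend on the approximating sequence. -/
theorem IsBorelExtension.unique {K : Set ℂ} (hd : IsTotallyDisconnected K) {z₀ z₁ : ℂ}
    {γ : Path z₀ z₁} (hγ : Function.Injective γ) {U : Set ℂ} {F G : ℂ → ℂ} {f g : ℕ → ℂ → ℂ}
    (hf : ∀ z ∈ range γ, z ∉ K → Tendsto (fun n => f n z) atTop (𝓝 (G z)))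
    (hg : ∀ z ∈ range γ, z ∉ K → Tendsto (fun n => g n z) atTop (𝓝 (G z))) {w w' : ℂ}
    (h : IsBorelExtension γ U F f w) (h' : IsBorelExtension γ U F g w') : w = w' := by
  obtain ⟨f₀, hfc, hfu, -, hfi, -⟩ := h
  obtain ⟨g₀, hgc, hgu, -, hgi, -⟩ := h'
  -- Both uniform limits equal the common pointwise limit `G` on a dense set of parameters, and they
  -- are continuous along `γ`.
  have hcomp : f₀ ∘ γ = g₀ ∘ γ := by
    refine Continuous.ext_on (dense_preimage_compl hd γ hγ)
      (hfc.comp_continuous γ.continuous mem_range_self)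
      (hgc.comp_continuous γ.continuous mem_range_self) fun t ht => ?_
    have hm := mem_range_self (f := γ) t
    exact (tendsto_nhds_unique (hfu.tendsto_at hm) (hf _ hm ht)).trans
      (tendsto_nhds_unique (hgu.tendsto_at hm) (hg _ hm ht)).symm
  have heq : EqOn f₀ g₀ (range γ) := by
    rintro _ ⟨t, rfl⟩
    exact congrFun hcomp t
  exact sub_left_injective ((hfi.congr heq).unique hgi)

end

/-! ### The perturbation lemma and the independence statement together -/

theorem mainTheorem7 (K : Set ℂ) (hK : IsPlaneCantorSet K) {z₀ z₁ : ℂ} (γ : Path z₀ z₁)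
    (hγ : Function.Injective γ) :
    -- the perturbation lemma
    (∀ ε > (0 : ℝ), ∃ η : Path z₀ z₁, IsJordanHomotopic ε γ η ∧
      ∀ t : unitInterval, t ≠ 0 → t ≠ 1 → η t ∉ K) ∧
    -- independence of the Borel extension from the approximating sequence
    (∀ μ : ComplexMeasure ℂ, csupport μ = K → μ (range γ) = 0 →
      ∀ (U : Set ℂ) (F : ℂ → ℂ), IsOpen U → z₀ ∈ U →
        (∀ z ∈ U, HasDerivAt F (cauchyTransform μ z) z) →
        ∀ f g : ℕ → ℂ → ℂ,
          (IsRationalApproximation γ μ f ∨ IsCauchyApproximation γ μ f) →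
          (IsRationalApproximation γ μ g ∨ IsCauchyApproximation γ μ g) →
          ∀ w w' : ℂ, IsBorelExtension γ U F f w → IsBorelExtension γ U F g w' → w = w') := by
  refine ⟨fun ε hε => exists_isJordanHomotopic hK.isCompact hK.totallyDisconnected γ hγ hε, ?_⟩
  rintro μ rfl - U F - - - f g hf hg w w' hw hw'
  -- Sequences of both kinds share the pointwise limit `cauchyTransform μ` off the support; in the
  -- rational case `z ∈ range γ` ensures that `z` is not a pole.
  have key : ∀ f : ℕ → ℂ → ℂ, (IsRationalApproximation γ μ f ∨ IsCauchyApproximation γ μ f) →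
      ∀ z ∈ range γ, z ∉ csupport μ →
        Tendsto (fun n => f n z) atTop (𝓝 (cauchyTransform μ z)) := fun f hf z hzγ hz =>
    hf.elim (fun h => h.tendsto hK.isCompact hzγ hz) fun h => h.tendsto hK.isCompact hz
  exact hw.unique hK.totallyDisconnected hγ (key f hf) (key g hg) hw'
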